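/- Let $(M,g)$ be a smooth Riemannian manifold (without boundary) with Levi-Civita connection $\nabla$ and curvature tensor $R$, and for $k\ge 0$ let $\mathscr R_k(X)U := (\nabla^k_{X,\dots,X}R)_{U,X}X$. Assume that $M$ is compact, or that $(M,g)$ is a naturally reductive space, i.e. $(M,g)$ is complete and there is a metric connection $\bar\nabla$ on $TM$ with $\bar\nabla$-parallel torsion and curvature such that $\bar\nabla=\nabla+\frac{\tau}{2}$ for an alternating $3$-form $\tau$. A linear Jacobi relation of order $d\in\{0,1,2,\dots\}$ is an identity $$\mathscr R_{d+1}=-a_2\|\cdot\|^2\mathscr R_{d-1}-a_4\|\cdot\|^4\mathscr R_{d-3}-\cdots-a_\vartheta\|\cdot\|^\vartheta\mathscr R_{d+1-\vartheta}$$ on $M$ with real constants $a_2,a_4,\dots,a_\vartheta$, where $\vartheta=2\lceil d/2\rceil$. Suppose that a linear Jacobi relation exists, consider one of minimal order $d$, and let $$P(\lambda)=\lambda^{d+1}+a_2\lambda^{d-1}+a_4\lambda^{d-3}+\cdots+a_\vartheta\lambda^{d+1-\vartheta}.$$ (1) Every complex root of $P$ is purely imaginary (possibly $0$) and simple. There exist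 real numbers $0<\lambda_1<\cdots<\lambda_{\lceil d/2\rceil}$ such that, with $Q(\lambda)=\prod_{\ell=1}^{\lceil d/2\rceil}(\lambda^2+\lambda_\ell^2)$, either $P(\lambda)=Q(\lambda)$ or $P(\lambda)=\lambda\,Q(\lambda)$. In particular all the coefficients $a_2,a_4,\dots,a_\vartheta$ are strictly positive. (2) If the Ricci tensor of $(M,g)$ is a Killing tensor, i.e. $(\nabla_X\mathrm{Ric})(X,X)=0$ for all $X$, and does not vanish identically, then $P(\lambda)=\lambda\,Q(\lambda)$, and in particular $d$ is even. -/

import Mathlib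

open Bundle Manifold Polynomial
open scoped ContDiff

noncomputable section

section Tensors

variable {n : ℕ} {M : Type*} [TopologicalSpace M] [ChartedSpace (EuclideanSpace ℝ (Fin n)) M]
  [IsManifold (𝓡 n) ∞ M]

/-- Affine connections on an `n`-dimensional manifold: Mathlib's covariant derivatives on the
tangent bundle. Mathlib's argument order is `D Y x (X x)` for `(∇_X Y)(x)`. -/
abbrev AffineConnection (n : ℕ) (M : Type*) [TopologicalSpace M]
    [ChartedSpace (EuclideanSpace ℝ (Fin n)) M] [IsManifold (𝓡 n) ∞ M] :=
  CovariantDerivative (𝓡 n) (EuclideanSpace ℝ (Fin n)) (fun x : M ↦ TangentSpace (𝓡 n) x)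

/-- Vector fields on `M` (no regularity). -/
abbrev VecField (n : ℕ) (M : Type*) [TopologicalSpace M]
    [ChartedSpace (EuclideanSpace ℝ (Fin n)) M] :=
  (x : M) → TangentSpace (𝓡 n) x

/-- The vector field is of class `C^∞` on all of `M`. -/
def IsSmoothField (X : VecField n M) : Prop :=
  ContMDiff (𝓡 n) (𝓡 n).tangent ∞ (fun x ↦ (⟨x, X x⟩ : TangentBundle (𝓡 n) M))

/-- The vector field `∇_X Y`. -/
def covAlong (D : AffineConnection n M) (X Y : VecField n M) : VecField n M :=
  fun x ↦ D Y x (X x)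

/-- The curvature `R_{X,Y} Z = ∇_X ∇_Y Z - ∇_Y ∇_X Z - ∇_{[X,Y]} Z`. -/
def curvatureField (D : AffineConnection n M) (X Y Z : VecField n M) : VecField n M :=
  covAlong D X (covAlong D Y Z) - covAlong D Y (covAlong D X Z)
    - covAlong D (VectorField.mlieBracket (𝓡 n) X Y) Z

/-- Tangent-valued covariant `m`-tensors, regarded as operators on `m`-tuples of vector fields. -/
abbrev FieldTensor (n : ℕ) (M : Type*) [TopologicalSpace M]
    [ChartedSpace (EuclideanSpace ℝ (Fin n)) M] (m : ℕ) :=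
  (Fin m → VecField n M) → VecField n M

/-- The curvature tensor, `(U, V, W) ↦ R_{U,V} W`. -/
def curvatureTensor (D : AffineConnection n M) : FieldTensor n M 3 :=
  fun Y ↦ curvatureField D (Y 0) (Y 1) (Y 2)

/-- The torsion tensor, `(U, V) ↦ ∇_U V - ∇_V U - [U, V]`. -/
def torsionTensor (D : AffineConnection n M) : FieldTensor n M 2 :=
  fun Y x ↦ D.torsion x (Y 0 x) (Y 1 x)

/-- The covariant derivative `∇T` of a tensor `T`, with the direction as the new first argument:
`(∇T)(X, Y₁, …, Yₘ) = ∇_X (T(Y₁, …, Yₘ)) - ∑ᵢ T(Y₁, …, ∇_X Yᵢ, …, Yₘ)`. -/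
def covDerivTensor (D : AffineConnection n M) {m : ℕ} (T : FieldTensor n M m) :
    FieldTensor n M (m + 1) :=
  fun Y ↦ covAlong D (Y 0) (T (Fin.tail Y))
    - ∑ i : Fin m, T (Function.update (Fin.tail Y) i (covAlong D (Y 0) (Fin.tail Y i)))

/-- The `k`-fold iterated covariant derivative `∇^k T`; the first `k` arguments are the
directions of differentiation. -/
def iterCovDeriv (D : AffineConnection n M) {m : ℕ} (T : FieldTensor n M m) :
    (k : ℕ) → FieldTensor n M (m + k)
  | 0 => T
  | k + 1 => covDerivTensor D (iterCovDeriv D T k)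

/-- The tensor `T` is `∇`-parallel, `∇T = 0`. -/
def IsParallelTensor (D : AffineConnection n M) {m : ℕ} (T : FieldTensor n M m) : Prop :=
  ∀ Y : Fin (m + 1) → VecField n M, (∀ i, IsSmoothField (Y i)) → covDerivTensor D T Y = 0

/-- The symmetrized `k`-th covariant derivative of the curvature tensor,
`𝓡_k(X) U = (∇^k_{X,…,X} R)_{U,X} X`: all arguments of `∇^k R` are `X`, except for the first
argument of the curvature tensor (the argument number `k`, counted from `0`), which is `U`. -/
def symCurvature (D : AffineConnection n M) (k : ℕ) (X U : VecField n M) : VecField n M :=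
  iterCovDeriv D (curvatureTensor D) k (fun i ↦ if (i : ℕ) = k then U else X)

end Tensors

section Riemannian

variable {n : ℕ} {M : Type*} [TopologicalSpace M] [ChartedSpace (EuclideanSpace ℝ (Fin n)) M]
  [IsManifold (𝓡 n) ∞ M] [RiemannianBundle (fun x : M ↦ TangentSpace (𝓡 n) x)]

/-- The Ricci tensor `Ric(v, w) = tr (u ↦ R_{u,v} w)` of the connection, the trace being computed
in an orthonormal basis of the tangent space. Tangent vectors at `x` are extended to vector fields
that are smooth near `x`; the value does not depend on the extension. -/
def ricciTensor (D : AffineConnection n M) (x : M) (v w : TangentSpace (𝓡 n) x) : ℝ :=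
  haveI : FiniteDimensional ℝ (TangentSpace (𝓡 n) x) :=
    inferInstanceAs (FiniteDimensional ℝ (EuclideanSpace ℝ (Fin n)))
  ∑ i, inner ℝ
    (curvatureField D
      (FiberBundle.extend (EuclideanSpace ℝ (Fin n))
        (stdOrthonormalBasis ℝ (TangentSpace (𝓡 n) x) i))
      (FiberBundle.extend (EuclideanSpace ℝ (Fin n)) v)
      (FiberBundle.extend (EuclideanSpace ℝ (Fin n)) w) x)
    (stdOrthonormalBasis ℝ (TangentSpace (𝓡 n) x) i)

/-- A symmetric `2`-tensor `b` is a Killing tensor: `(∇_X b)(X, X) = 0` for all `X`. -/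
def IsKillingTensor (D : AffineConnection n M)
    (b : (x : M) → TangentSpace (𝓡 n) x → TangentSpace (𝓡 n) x → ℝ) : Prop :=
  ∀ X : VecField n M, IsSmoothField X → ∀ x : M,
    mvfderiv (𝓡 n) (fun y : M ↦ b y (X y) (X y)) x (X x)
      - b x (covAlong D X X x) (X x) - b x (X x) (covAlong D X X x) = 0

/-- The sequence `a` gives a linear Jacobi relation of order `d`:
`𝓡_{d+1} = - a₂ ‖·‖² 𝓡_{d-1} - a₄ ‖·‖⁴ 𝓡_{d-3} - …`. The sum runs over the even numbers `2 i`
with `2 ≤ 2 i ≤ d + 1`, and only these entries of `a` matter. -/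
def IsLinearJacobiRelation (D : AffineConnection n M) (d : ℕ) (a : ℕ → ℝ) : Prop :=
  ∀ X U : VecField n M, IsSmoothField X → IsSmoothField U → ∀ x : M,
    symCurvature D (d + 1) X U x
      = -∑ i ∈ Finset.Icc 1 ((d + 1) / 2),
          (a (2 * i) * ‖X x‖ ^ (2 * i)) • symCurvature D (d + 1 - 2 * i) X U x

/-- A linear Jacobi relation whose order is the smallest possible one. -/
def IsMinimalLinearJacobiRelation (D : AffineConnection n M) (d : ℕ) (a : ℕ → ℝ) : Prop :=
  IsLinearJacobiRelation D d a ∧ ∀ d' a', IsLinearJacobiRelation D d' a' → d ≤ d'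

/-- The polynomial `P = λ^{d+1} + a₂ λ^{d-1} + a₄ λ^{d-3} + …` of a linear Jacobi relation. -/
def jacobiPolynomial (d : ℕ) (a : ℕ → ℝ) : ℝ[X] :=
  X ^ (d + 1) + ∑ i ∈ Finset.Icc 1 ((d + 1) / 2), C (a (2 * i)) * X ^ (d + 1 - 2 * i)

variable [IsContMDiffRiemannianBundle (𝓡 n) ∞ (EuclideanSpace ℝ (Fin n))
    (fun x : M ↦ TangentSpace (𝓡 n) x)]

/-- A smooth Riemannian metric is in particular of class `C^1`. -/
instance isContMDiffRiemannianBundle_one_of_smooth :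
    IsContMDiffRiemannianBundle (𝓡 n) 1 (EuclideanSpace ℝ (Fin n))
      (fun x : M ↦ TangentSpace (𝓡 n) x) :=
  IsContMDiffRiemannianBundle.of_le (n := ∞) (by exact_mod_cast le_top)

/-- The Levi-Civita connection: the smooth, metric and torsion-free connection. -/
structure IsLeviCivita (D : AffineConnection n M) : Prop where
  smooth : D.ContMDiffCovariantDerivative ∞
  metric : D.IsMetricCompatible
  torsion_free : D.torsion = 0

/-- Ambrose-Singer connections: smooth metric connections with parallel torsion and parallel
curvature. -/
structure IsAmbroseSinger (D : AffineConnection n M) : Prop where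
  smooth : D.ContMDiffCovariantDerivative ∞
  metric : D.IsMetricCompatible
  parallel_torsion : IsParallelTensor D (torsionTensor D)
  parallel_curvature : IsParallelTensor D (curvatureTensor D)

/-- The `3`-tensor `τ` with `D' = D + τ / 2`, that is `τ(u, v, w) = 2 ⟨D'_u v - D_u v, w⟩`. -/
def differenceTensor (D D' : AffineConnection n M) (x : M) (u v w : TangentSpace (𝓡 n) x) : ℝ :=
  2 * inner ℝ (D'.difference D x v u) w

end Riemannian

/-- `(M, g, D')` is a naturally reductive space, where `D` is the Levi-Civita connection of the
metric `g`: the Riemannian manifold `(M, g)` is complete, `D'` is an Ambrose-Singer connection,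
and the tensor `τ` with `D' = D + τ / 2` is alternating. -/
structure IsNaturallyReductive {n : ℕ} {M : Type*} [EMetricSpace M]
    [ChartedSpace (EuclideanSpace ℝ (Fin n)) M] [IsManifold (𝓡 n) ∞ M]
    [RiemannianBundle (fun x : M ↦ TangentSpace (𝓡 n) x)]
    [IsContMDiffRiemannianBundle (𝓡 n) ∞ (EuclideanSpace ℝ (Fin n))
      (fun x : M ↦ TangentSpace (𝓡 n) x)]
    [IsRiemannianManifold (𝓡 n) M]
    (D D' : AffineConnection n M) : Prop where
  complete : CompleteSpace M
  ambrose_singer : IsAmbroseSinger D'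
  alternating : ∀ (x : M) (u v : TangentSpace (𝓡 n) x),
    differenceTensor D D' x u u v = 0 ∧ differenceTensor D D' x u v v = 0 ∧
      differenceTensor D D' x u v u = 0

end

/-! For unit vectors v, u, w at a point, form the real sequence y_k = ⟨𝓡_k(v)u, w⟩, and let `jetSet`
be the set of all these sequences. By homogeneity in v, u and w, a linear Jacobi relation of order d
holds exactly when its polynomial P annihilates every such sequence under the pairing X^k ↦ y_k
(`isLinearJacobiRelation_iff_jetSet`). Moving v, u, w infinitesimally by parallel transport in the
direction v changes y_k at the rate y_(k+1). The shift is therefore a tangent vector field, and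
multiplication of polynomials by X is differentiation.

Each sequence lies in a compact subset of `jetSet` to which the shift is tangent. If M is compact,
this is the whole of `jetSet` (`isShiftFlow_jetSet`). In the naturally reductive case, with A = ∇' -
∇, the operators satisfy 𝓡_(k+1)(v) = [𝓡_k(v), A_v] with A_v skew
(`IsParallelPair.jacobiOperator_succ`), so v can be kept fixed while u and w run over the unit
sphere of one tangent space.

On a compact set with such a flow, the derivative of a function vanishes at its maximum. If (X - μ)q
annihilates the set and Re μ ≠ 0, then |q(y)|² grows at the rate 2 Re μ |q(y)|², so q annihilates it
as well. If (X - μ)²q annihilates it and Re μ = 0, then with r = (X - μ)q the quantity |r|² is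
stationary while ⟨q, r⟩ grows at the rate |r|², which boundedness forbids unless r annihilates the
set. A root of P off the imaginary axis, or a multiple root, would thus leave a monic annihilator of
degree d. Replacing v by -v separates parities and turns that annihilator into a Jacobi relation of
smaller order, contrary to minimality; the case d = 0, where P = X, is checked directly.

Since P is real, its nonzero roots come in pairs ±iλ, which gives the product and the positivity of
the coefficients. For the second assertion, tr 𝓡_0(v) = Ric(v, v), and the Killing condition makes
tr 𝓡_k vanish for all k ≥ 1. If d + 1 were even, the trace of the relation would reduce to its last
term, a positive multiple of Ric(v, v) for v ≠ 0, and Ric would vanish. -/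

noncomputable section

open scoped Topology

/-! ### Smoothness and dimension instances. -/

section Instances

variable {n : ℕ} {M : Type*} [TopologicalSpace M] [ChartedSpace (EuclideanSpace ℝ (Fin n)) M]

lemma isManifold_minSmoothness_two [IsManifold (𝓡 n) ∞ M] :
    IsManifold (𝓡 n) (minSmoothness ℝ 2) M :=
  IsManifold.of_le (n := ∞) (by simpa using ENat.LEInfty.out)

lemma isManifold_minSmoothness_three [IsManifold (𝓡 n) ∞ M] :
    IsManifold (𝓡 n) (minSmoothness ℝ 3) M :=
  IsManifold.of_le (n := ∞) (by simpa using ENat.LEInfty.out)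

lemma finiteDimensional_tangentSpace (x : M) : FiniteDimensional ℝ (TangentSpace (𝓡 n) x) :=
  inferInstanceAs (FiniteDimensional ℝ (EuclideanSpace ℝ (Fin n)))

end Instances

attribute [local instance] isManifold_minSmoothness_two isManifold_minSmoothness_three
  finiteDimensional_tangentSpace

/-! ### Globally smooth vector fields with prescribed germs, values and local frames. -/

section SmoothFields

variable {n : ℕ} {M : Type*} [TopologicalSpace M] [ChartedSpace (EuclideanSpace ℝ (Fin n)) M]
  [IsManifold (𝓡 n) ∞ M]

namespace IsSmoothField

variable {X Y : VecField n M}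

lemma mdifferentiableAt (hX : IsSmoothField X) (x : M) :
    MDifferentiableAt (𝓡 n) (𝓡 n).tangent (fun y ↦ (⟨y, X y⟩ : TangentBundle (𝓡 n) M)) x :=
  ContMDiff.mdifferentiable hX (by simp) x

lemma add (hX : IsSmoothField X) (hY : IsSmoothField Y) : IsSmoothField (X + Y) :=
  ContMDiff.add_section hX hY

lemma sub (hX : IsSmoothField X) (hY : IsSmoothField Y) : IsSmoothField (X - Y) :=
  ContMDiff.sub_section hX hY

lemma neg (hX : IsSmoothField X) : IsSmoothField (-X) :=
  ContMDiff.neg_section hX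

lemma smul {f : M → ℝ} (hf : ContMDiff (𝓡 n) 𝓘(ℝ) ∞ f) (hX : IsSmoothField X) :
    IsSmoothField (f • X) :=
  ContMDiff.smul_section hf hX

lemma sum {ι : Type*} {s : Finset ι} {Y : ι → VecField n M}
    (hY : ∀ i ∈ s, IsSmoothField (Y i)) : IsSmoothField (∑ i ∈ s, Y i) := by
  have := ContMDiff.sum_section (s := s) (t := Y) (I := 𝓡 n) (F := EuclideanSpace ℝ (Fin n))
    (n := ∞) hY
  unfold IsSmoothField
  convert! this using 3
  exact Finset.sum_apply _ _ _

lemma covAlong {D : AffineConnection n M} (hD : D.ContMDiffCovariantDerivative ∞)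
    (hX : IsSmoothField X) (hY : IsSmoothField Y) : IsSmoothField (covAlong D X Y) := by
  have h1 := hD.contMDiff.contMDiff (σ := Y) (contMDiffOn_univ.2 hY)
  rw [contMDiffOn_univ] at h1
  exact ContMDiff.clm_bundle_apply (b := fun x : M ↦ x) h1 hX

lemma mlieBracket (hX : IsSmoothField X) (hY : IsSmoothField Y) :
    IsSmoothField (VectorField.mlieBracket (𝓡 n) X Y) := by
  have : IsManifold (𝓡 n) (((⊤ : ℕ∞) : ℕ∞ω) + 1) M := by
    simpa using (inferInstance : IsManifold (𝓡 n) ∞ M)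
  exact ContDiff.mlieBracket_vectorField (n := ⊤) (m := ⊤) (I := 𝓡 n) hX hY (by simp)

end IsSmoothField

lemma isSmoothField_zero : IsSmoothField (0 : VecField n M) :=
  contMDiff_zeroSection ℝ _

variable [T2Space M]

/-- A field which is smooth near a point agrees near this point with a globally smooth field. -/
lemma exists_isSmoothField_eventuallyEq {x : M} {s : Set M} (hs : s ∈ 𝓝 x) {Y : VecField n M}
    (hY : ContMDiffOn (𝓡 n) (𝓡 n).tangent ∞ (fun y ↦ (⟨y, Y y⟩ : TangentBundle (𝓡 n) M)) s) :
    ∃ Z : VecField n M, IsSmoothField Z ∧ ∀ᶠ y in 𝓝 x, Z y = Y y := by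
  obtain ⟨f, hf, -⟩ := (SmoothBumpFunction.nhds_basis_support (I := 𝓡 n)
    (interior_mem_nhds.2 hs)).mem_iff.1 (interior_mem_nhds.2 hs)
  refine ⟨(f : M → ℝ) • Y, ?_, ?_⟩
  · exact ContMDiffOn.smul_section_of_tsupport f.contMDiff.contMDiffOn isOpen_interior hf
      (hY.mono interior_subset)
  · filter_upwards [f.eventuallyEq_one] with y hy
    simp [hy]

lemma exists_isSmoothField_eventuallyEq_extend {x : M} (v : TangentSpace (𝓡 n) x) :
    ∃ Z : VecField n M, IsSmoothField Z ∧
      ∀ᶠ y in 𝓝 x, Z y = FiberBundle.extend (E := fun x : M ↦ TangentSpace (𝓡 n) x)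
        (EuclideanSpace ℝ (Fin n)) v y := by
  obtain ⟨s, hs, h⟩ := FiberBundle.exists_contMDiffOn_extend (k := ∞) (𝓡 n)
    (EuclideanSpace ℝ (Fin n)) v
  exact exists_isSmoothField_eventuallyEq hs h

/-- A globally smooth vector field with a given value. -/
def smoothExtend {x : M} (v : TangentSpace (𝓡 n) x) : VecField n M :=
  (exists_isSmoothField_eventuallyEq_extend v).choose

lemma isSmoothField_smoothExtend {x : M} (v : TangentSpace (𝓡 n) x) :
    IsSmoothField (smoothExtend v) :=
  (exists_isSmoothField_eventuallyEq_extend v).choose_spec.1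

lemma smoothExtend_eventuallyEq {x : M} (v : TangentSpace (𝓡 n) x) :
    smoothExtend v =ᶠ[𝓝 x] FiberBundle.extend (E := fun x : M ↦ TangentSpace (𝓡 n) x)
      (EuclideanSpace ℝ (Fin n)) v :=
  (exists_isSmoothField_eventuallyEq_extend v).choose_spec.2

@[simp]
lemma smoothExtend_self {x : M} (v : TangentSpace (𝓡 n) x) : smoothExtend v x = v := by
  exact (smoothExtend_eventuallyEq v).self_of_nhds.trans (FiberBundle.extend_apply_self _ v)

lemma exists_contMDiff_eventuallyEq {x : M} {s : Set M} (hs : s ∈ 𝓝 x) {g : M → ℝ}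
    (hg : ContMDiffOn (𝓡 n) 𝓘(ℝ) ∞ g s) :
    ∃ h : M → ℝ, ContMDiff (𝓡 n) 𝓘(ℝ) ∞ h ∧ h =ᶠ[𝓝 x] g := by
  obtain ⟨f, hf, -⟩ := (SmoothBumpFunction.nhds_basis_support (I := 𝓡 n)
    (interior_mem_nhds.2 hs)).mem_iff.1 (interior_mem_nhds.2 hs)
  refine ⟨(f : M → ℝ) • g, contMDiff_of_tsupport fun y hy ↦ ?_, ?_⟩
  · have hy' := hf (tsupport_smul_subset_left _ _ hy)
    exact f.contMDiff.contMDiffAt.smul (hg.contMDiffAt (mem_interior_iff_mem_nhds.1 hy'))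
  · filter_upwards [f.eventuallyEq_one] with y hy
    simp [hy]

/-- Near every point there is a frame of globally smooth vector fields, with respect to which
all smooth fields have smooth coefficients. -/
lemma exists_smooth_frame_coeff (x : M) :
    ∃ E : Fin n → VecField n M, (∀ i, IsSmoothField (E i)) ∧
      (∀ᶠ y in 𝓝 x, LinearIndependent ℝ (fun i ↦ E i y) ∧
        ⊤ ≤ Submodule.span ℝ (Set.range fun i ↦ E i y)) ∧
      ∀ Y, IsSmoothField Y → ∃ c : Fin n → M → ℝ, (∀ i, ContMDiff (𝓡 n) 𝓘(ℝ) ∞ (c i)) ∧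
        ∀ᶠ y in 𝓝 x, Y y = ∑ i, c i y • E i y := by
  let e := trivializationAt (EuclideanSpace ℝ (Fin n)) (fun x : M ↦ TangentSpace (𝓡 n) x) x
  let b := (EuclideanSpace.basisFun (Fin n) ℝ).toBasis
  have hx : x ∈ e.baseSet := FiberBundle.mem_baseSet_trivializationAt' x
  have he := e.open_baseSet.mem_nhds hx
  have hfr := e.isLocalFrameOn_localFrame_baseSet (𝓡 n) ∞ b
  choose E hE hEq using fun i ↦ exists_isSmoothField_eventuallyEq (n := n) he (hfr.contMDiffOn i)
  refine ⟨E, hE, ?_, fun Y hY ↦ ?_⟩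
  · filter_upwards [he, Filter.eventually_all.2 hEq] with y hy h
    simp only [h]
    exact ⟨hfr.linearIndependent hy, hfr.generating hy⟩
  · choose c hc hcEq using fun i ↦ exists_contMDiff_eventuallyEq he
      (contMDiffOn_baseSet_localFrameCoeff (e := e) b (k := ∞) hY.contMDiffOn i)
    refine ⟨c, hc, ?_⟩
    filter_upwards [he, Filter.eventually_all.2 hEq, Filter.eventually_all.2 hcEq] with y hy h1 h2
    simp only [h1, h2]
    exact e.eq_sum_localFrameCoeff_smul (I := 𝓡 n) (b := b) (s := Y) hy

end SmoothFields

/-! ### Function-linear operators on vector fields and their pointwise values. -/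

section TensorFields

variable {n : ℕ} {M : Type*} [TopologicalSpace M] [ChartedSpace (EuclideanSpace ℝ (Fin n)) M]
  [IsManifold (𝓡 n) ∞ M]

section CovAlong

variable (D : AffineConnection n M) {X X' Y Y' : VecField n M}

lemma covAlong_add_left : covAlong D (X + X') Y = covAlong D X Y + covAlong D X' Y := by
  ext1 x; simp [covAlong]

lemma covAlong_sub_left : covAlong D (X - X') Y = covAlong D X Y - covAlong D X' Y := by
  ext1 x; simp [covAlong]

lemma covAlong_smul_left (f : M → ℝ) : covAlong D (f • X) Y = f • covAlong D X Y := by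
  ext1 x; simp [covAlong]

lemma covAlong_add_right (hY : IsSmoothField Y) (hY' : IsSmoothField Y') :
    covAlong D X (Y + Y') = covAlong D X Y + covAlong D X Y' := by
  ext1 x
  simp [covAlong,
    D.isCovariantDerivativeOnUniv.add (hY.mdifferentiableAt x) (hY'.mdifferentiableAt x)]

lemma covAlong_smul_right {f : M → ℝ} (hf : ContMDiff (𝓡 n) 𝓘(ℝ) ∞ f) (hY : IsSmoothField Y) :
    covAlong D X (f • Y) = f • covAlong D X Y + (fun x ↦ mvfderiv (𝓡 n) f x (X x)) • Y := by
  ext1 x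
  simp [covAlong, D.isCovariantDerivativeOnUniv.leibniz (hY.mdifferentiableAt x)
    (hf.mdifferentiable (by simp) x)]

lemma covAlong_const_smul_right (c : ℝ) (hY : IsSmoothField Y) :
    covAlong D X (c • Y) = c • covAlong D X Y := by
  ext1 x
  simp [covAlong, D.isCovariantDerivativeOnUniv.smul_const c (hY.mdifferentiableAt x)]

lemma covAlong_neg_right (hY : IsSmoothField Y) : covAlong D X (-Y) = -covAlong D X Y := by
  simpa using covAlong_const_smul_right D (X := X) (-1) hY

lemma covAlong_sub_right (hY : IsSmoothField Y) (hY' : IsSmoothField Y') :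
    covAlong D X (Y - Y') = covAlong D X Y - covAlong D X Y' := by
  rw [sub_eq_add_neg, covAlong_add_right D hY hY'.neg, covAlong_neg_right D hY', sub_eq_add_neg]

end CovAlong

/-- Tensor fields: operators on tuples of vector fields which preserve smoothness and which are
linear over the smooth functions in every argument. -/
structure IsTensorField {m : ℕ} (T : FieldTensor n M m) : Prop where
  smooth : ∀ {Y : Fin m → VecField n M}, (∀ i, IsSmoothField (Y i)) → IsSmoothField (T Y)
  add : ∀ {Y : Fin m → VecField n M} (i : Fin m) {Z Z' : VecField n M},
    (∀ i, IsSmoothField (Y i)) → IsSmoothField Z → IsSmoothField Z' →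
    T (Function.update Y i (Z + Z')) = T (Function.update Y i Z) + T (Function.update Y i Z')
  smul : ∀ {Y : Fin m → VecField n M} (i : Fin m) {f : M → ℝ} {Z : VecField n M},
    (∀ i, IsSmoothField (Y i)) → ContMDiff (𝓡 n) 𝓘(ℝ) ∞ f → IsSmoothField Z →
    T (Function.update Y i (f • Z)) = f • T (Function.update Y i Z)

lemma IsSmoothField.update {m : ℕ} {Y : Fin m → VecField n M} (hY : ∀ i, IsSmoothField (Y i))
    (i : Fin m) {Z : VecField n M} (hZ : IsSmoothField Z) (j : Fin m) :
    IsSmoothField (Function.update Y i Z j) := by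
  rcases eq_or_ne j i with rfl | h
  · simpa using hZ
  · simpa [h] using hY j

lemma IsSmoothField.contMDiff_mvfderiv {X : VecField n M} (hX : IsSmoothField X) {f : M → ℝ}
    (hf : ContMDiff (𝓡 n) 𝓘(ℝ) ∞ f) :
    ContMDiff (𝓡 n) 𝓘(ℝ) ∞ (fun x ↦ mvfderiv (𝓡 n) f x (X x)) := by
  have h1 : ContMDiff (𝓡 n).tangent (𝓘(ℝ, ℝ)).tangent ∞ (tangentMap (𝓡 n) 𝓘(ℝ, ℝ) f) :=
    hf.contMDiff_tangentMap (by simp)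
  exact (contMDiff_snd_tangentBundle_modelSpace ℝ 𝓘(ℝ, ℝ)).comp (h1.comp hX)

section CovDeriv

variable {m : ℕ} {T : FieldTensor n M m} {D : AffineConnection n M}

lemma covDerivTensor_cons (X : VecField n M) (Y : Fin m → VecField n M) :
    covDerivTensor D T (Fin.cons X Y) = covAlong D X (T Y)
      - ∑ i : Fin m, T (Function.update Y i (covAlong D X (Y i))) := by
  simp [covDerivTensor]

/-- The slot that holds Z is split off from the others, since only there do derivatives of Z appear.
In the remaining sum Z is undifferentiated. -/
lemma covDerivTensor_cons_update (X : VecField n M) (Y : Fin m → VecField n M) (j : Fin m)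
    (Z : VecField n M) :
    covDerivTensor D T (Fin.cons X (Function.update Y j Z)) =
      covAlong D X (T (Function.update Y j Z)) - T (Function.update Y j (covAlong D X Z))
      - ∑ i ∈ Finset.univ.erase j,
        T (Function.update (Function.update Y i (covAlong D X (Y i))) j Z) := by
  rw [covDerivTensor_cons, ← Finset.add_sum_erase _ _ (Finset.mem_univ j), sub_sub]
  congr 2
  · simp
  · refine Finset.sum_congr rfl fun i hi ↦ ?_
    have hij : i ≠ j := Finset.ne_of_mem_erase hi
    rw [Function.update_of_ne hij, Function.update_comm hij]

/-- In the direction slot, linearity comes from that of the connection. In any other slot the term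
df(X) T(…, Z, …) arises twice, from differentiating f T and from inserting ∇_X(f Z), and cancels. -/
lemma IsTensorField.covDerivTensor (hT : IsTensorField T) (hD : D.ContMDiffCovariantDerivative ∞) :
    IsTensorField (covDerivTensor D T) where
  smooth {Y} hY := by
    refine IsSmoothField.sub (.covAlong hD (hY 0) (hT.smooth fun i ↦ hY i.succ)) (.sum ?_)
    exact fun i _ ↦ hT.smooth (IsSmoothField.update (fun j ↦ hY j.succ) i
      (.covAlong hD (hY 0) (hY i.succ)))
  add {Y} i {Z Z'} hY hZ hZ' := by
    obtain ⟨X, Y, rfl⟩ : ∃ X Y', Y = Fin.cons X Y' := ⟨_, _, (Fin.cons_self_tail Y).symm⟩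
    have hX : IsSmoothField X := by simpa using hY 0
    replace hY : ∀ i, IsSmoothField (Y i) := fun i ↦ by simpa using hY i.succ
    cases i using Fin.cases with
    | zero =>
      simp only [Fin.update_cons_zero, covDerivTensor_cons, covAlong_add_left]
      rw [Finset.sum_congr rfl fun i _ ↦ hT.add i hY (.covAlong hD hZ (hY i))
        (.covAlong hD hZ' (hY i)), Finset.sum_add_distrib]
      abel
    | succ j =>
      simp only [← Fin.cons_update, covDerivTensor_cons_update]
      rw [hT.add j hY hZ hZ', covAlong_add_right D hZ hZ', hT.add j hY (.covAlong hD hX hZ)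
        (.covAlong hD hX hZ'), covAlong_add_right D (hT.smooth (.update hY j hZ))
        (hT.smooth (.update hY j hZ')),
        Finset.sum_congr rfl fun i _ ↦ hT.add j (.update hY i (.covAlong hD hX (hY i))) hZ hZ',
        Finset.sum_add_distrib]
      abel
  smul {Y} i {f Z} hY hf hZ := by
    obtain ⟨X, Y, rfl⟩ : ∃ X Y', Y = Fin.cons X Y' := ⟨_, _, (Fin.cons_self_tail Y).symm⟩
    have hX : IsSmoothField X := by simpa using hY 0
    replace hY : ∀ i, IsSmoothField (Y i) := fun i ↦ by simpa using hY i.succ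
    cases i using Fin.cases with
    | zero =>
      simp only [Fin.update_cons_zero, covDerivTensor_cons, covAlong_smul_left]
      rw [Finset.sum_congr rfl fun i _ ↦ hT.smul i hY hf (.covAlong hD hZ (hY i)),
        ← Finset.smul_sum, smul_sub]
    | succ j =>
      have hdf := hX.contMDiff_mvfderiv hf
      simp only [← Fin.cons_update, covDerivTensor_cons_update]
      rw [hT.smul j hY hf hZ, covAlong_smul_right D hf hZ,
        hT.add j hY (.smul hf (.covAlong hD hX hZ)) (.smul hdf hZ),
        hT.smul j hY hf (.covAlong hD hX hZ), hT.smul j hY hdf hZ,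
        covAlong_smul_right D hf (hT.smooth (.update hY j hZ)),
        Finset.sum_congr rfl fun i _ ↦ hT.smul j (.update hY i (.covAlong hD hX (hY i))) hf hZ,
        ← Finset.smul_sum, smul_sub, smul_sub]
      abel

lemma IsTensorField.iterCovDeriv (hT : IsTensorField T) (hD : D.ContMDiffCovariantDerivative ∞)
    (k : ℕ) : IsTensorField (iterCovDeriv D T k) := by
  induction k with
  | zero => exact hT
  | succ k ih => exact ih.covDerivTensor hD

end CovDeriv

variable [T2Space M] {m : ℕ} {T : FieldTensor n M m}

namespace IsTensorField

omit [T2Space M] in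
lemma map_sum (hT : IsTensorField T) {ι : Type*} (s : Finset ι) {Y : Fin m → VecField n M}
    (hY : ∀ i, IsSmoothField (Y i)) (i : Fin m) {Z : ι → VecField n M}
    (hZ : ∀ j, IsSmoothField (Z j)) :
    T (Function.update Y i (∑ j ∈ s, Z j)) = ∑ j ∈ s, T (Function.update Y i (Z j)) := by
  classical
  induction s using Finset.induction_on with
  | empty =>
    have := hT.smul i (f := 0) (Z := 0) hY contMDiff_const isSmoothField_zero
    simpa using this
  | insert a s ha ih =>
    rw [Finset.sum_insert ha, Finset.sum_insert ha,
      hT.add i hY (hZ a) (.sum fun j _ ↦ hZ j), ih]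

/-- Expanding Z in a local frame, cut off to be globally smooth, lets the coefficients be pulled out
of T; they vanish at x along with Z. -/
lemma eq_zero_of_eq_zero (hT : IsTensorField T) {Y : Fin m → VecField n M}
    (hY : ∀ i, IsSmoothField (Y i)) (i : Fin m) {Z : VecField n M} (hZ : IsSmoothField Z)
    {x : M} (hZx : Z x = 0) : T (Function.update Y i Z) x = 0 := by
  let e := trivializationAt (EuclideanSpace ℝ (Fin n)) (fun x : M ↦ TangentSpace (𝓡 n) x) x
  have hx : x ∈ e.baseSet := FiberBundle.mem_baseSet_trivializationAt' x
  let b := (EuclideanSpace.basisFun (Fin n) ℝ).toBasis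
  have hfr := e.isLocalFrameOn_localFrame_baseSet (𝓡 n) ∞ b
  obtain ⟨φ, hφ, -⟩ := (SmoothBumpFunction.nhds_basis_support (I := 𝓡 n)
    (e.open_baseSet.mem_nhds hx)).mem_iff.1 (e.open_baseSet.mem_nhds hx)
  let E : Fin n → VecField n M := fun j ↦ (φ : M → ℝ) • e.localFrame b j
  have hE : ∀ j, IsSmoothField (E j) := fun j ↦
    ContMDiffOn.smul_section_of_tsupport φ.contMDiff.contMDiffOn e.open_baseSet hφ
      (hfr.contMDiffOn j)
  let c : Fin n → M → ℝ := fun j y ↦ φ y * e.localFrameCoeff (𝓡 n) b j y (Z y)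
  have hc : ∀ j, ContMDiff (𝓡 n) 𝓘(ℝ) ∞ (c j) := by
    intro j
    have := φ.contMDiff_smul (g := fun y ↦ e.localFrameCoeff (𝓡 n) b j y (Z y))
      (contMDiffOn_localFrameCoeff b (chartAt _ x).open_source
        (by simp [e, TangentBundle.trivializationAt_baseSet]) hZ.contMDiffOn j)
    simpa [c] using this
  -- The bump function enters squared: one factor makes the frame global, the other makes the
  -- coefficients global.
  have hdecomp : ((φ : M → ℝ) * φ) • Z = ∑ j, c j • E j := by
    ext1 y
    rw [Finset.sum_apply]
    by_cases hy : y ∈ e.baseSet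
    · have := e.eq_sum_localFrameCoeff_smul (I := 𝓡 n) (b := b) (s := Z) hy
      simp only [Pi.smul_apply', Pi.mul_apply, c, E]
      conv_lhs => rw [this]
      rw [Finset.smul_sum]
      exact Finset.sum_congr rfl fun j _ ↦ by simp only [smul_smul]; ring_nf
    · have : φ y = 0 := by
        by_contra h
        exact hy (hφ (subset_tsupport _ h))
      simp [c, this]
  have h1 := hT.smul i (f := (φ : M → ℝ) * φ) hY (φ.contMDiff.mul φ.contMDiff) hZ
  rw [hdecomp, hT.map_sum _ hY i fun j ↦ .smul (hc j) (hE j)] at h1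
  have h2 := congrFun h1 x
  rw [Finset.sum_apply] at h2
  simp only [hT.smul i hY (hc _) (hE _)] at h2
  simpa [c, hZx] using h2.symm

/-- The arguments are exchanged one at a time, each exchange being harmless by `eq_zero_of_eq_zero`.
-/
lemma congr_at (hT : IsTensorField T) {Y Y' : Fin m → VecField n M}
    (hY : ∀ i, IsSmoothField (Y i)) (hY' : ∀ i, IsSmoothField (Y' i)) {x : M}
    (h : ∀ i, Y i x = Y' i x) : T Y x = T Y' x := by
  classical
  suffices H : ∀ s : Finset (Fin m), T (s.piecewise Y' Y) x = T Y x by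
    simpa using (H Finset.univ).symm
  intro s
  induction s using Finset.induction_on with
  | empty => simp
  | insert a s ha ih =>
    have hs : ∀ i, IsSmoothField (s.piecewise Y' Y i) := fun i ↦ by
      by_cases hi : i ∈ s <;> simp [hi, hY, hY']
    rw [← ih, Finset.piecewise_insert, ← sub_eq_zero]
    have h1 : s.piecewise Y' Y = Function.update (s.piecewise Y' Y) a (Y a) := by
      rw [eq_comm, Function.update_eq_self_iff]; simp [ha]
    have h2 := hT.eq_zero_of_eq_zero hs a ((hY' a).sub (hY a)) (x := x) (by simp [h])
    have h3 := hT.add a hs ((hY' a).sub (hY a)) (hY a)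
    rw [sub_add_cancel, ← h1] at h3
    rw [h3]
    simpa using h2

lemma smoothExtend_update (hT : IsTensorField T) {x : M} (v : Fin m → TangentSpace (𝓡 n) x)
    (i : Fin m) {Z : VecField n M} (hZ : IsSmoothField Z) :
    T (fun j ↦ smoothExtend (Function.update v i (Z x) j)) x =
      T (Function.update (fun j ↦ smoothExtend (v j)) i Z) x := by
  refine hT.congr_at (fun _ ↦ isSmoothField_smoothExtend _)
    (IsSmoothField.update (fun _ ↦ isSmoothField_smoothExtend _) i hZ) fun j ↦ ?_
  rcases eq_or_ne j i with rfl | h <;> simp [*]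

/-- The multilinear map on the tangent space given by a tensor field. -/
def toMultilinear (hT : IsTensorField T) (x : M) :
    MultilinearMap ℝ (fun _ : Fin m ↦ TangentSpace (𝓡 n) x) (TangentSpace (𝓡 n) x) where
  toFun v := T (fun i ↦ smoothExtend (v i)) x
  map_update_add' {inst} v i a b := by
    obtain rfl : inst = instDecidableEqFin m := Subsingleton.elim _ _
    have ha := isSmoothField_smoothExtend a
    have hb := isSmoothField_smoothExtend b
    have h1 := hT.smoothExtend_update v i (ha.add hb)
    have h2 := hT.smoothExtend_update v i ha
    have h3 := hT.smoothExtend_update v i hb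
    rw [hT.add i (fun _ ↦ isSmoothField_smoothExtend _) ha hb] at h1
    simp only [Pi.add_apply, smoothExtend_self] at h1 h2 h3
    rw [h1, h2, h3]
  map_update_smul' {inst} v i c a := by
    obtain rfl : inst = instDecidableEqFin m := Subsingleton.elim _ _
    have ha := isSmoothField_smoothExtend a
    have hc : ContMDiff (𝓡 n) 𝓘(ℝ) ∞ (fun _ : M ↦ c) := contMDiff_const
    have h1 := hT.smoothExtend_update v i (ha.smul hc)
    have h2 := hT.smoothExtend_update v i ha
    rw [hT.smul i (fun _ ↦ isSmoothField_smoothExtend _) hc ha] at h1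
    simp only [Pi.smul_apply', smoothExtend_self] at h1 h2
    rw [h1, h2]

lemma toMultilinear_apply (hT : IsTensorField T) {Y : Fin m → VecField n M}
    (hY : ∀ i, IsSmoothField (Y i)) (x : M) : hT.toMultilinear x (fun i ↦ Y i x) = T Y x :=
  hT.congr_at (fun _ ↦ isSmoothField_smoothExtend _) hY fun _ ↦ smoothExtend_self _

end IsTensorField

end TensorFields

/-! ### Lie brackets and the tensoriality of the curvature. -/

section Curvature

variable {n : ℕ} {M : Type*} [TopologicalSpace M] [ChartedSpace (EuclideanSpace ℝ (Fin n)) M]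
  [IsManifold (𝓡 n) ∞ M]

section LieBracket

variable {X X' Y Z : VecField n M}

open VectorField

lemma mlieBracket_smul_right_field {f : M → ℝ} (hf : ContMDiff (𝓡 n) 𝓘(ℝ) ∞ f)
    (hY : IsSmoothField Y) :
    mlieBracket (𝓡 n) X (f • Y) =
      (fun x ↦ mvfderiv (𝓡 n) f x (X x)) • Y + f • mlieBracket (𝓡 n) X Y := by
  ext1 x
  exact mlieBracket_smul_right (hf.mdifferentiable (by simp) x) (hY.mdifferentiableAt x)

lemma mlieBracket_smul_left_field {f : M → ℝ} (hf : ContMDiff (𝓡 n) 𝓘(ℝ) ∞ f)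
    (hX : IsSmoothField X) :
    mlieBracket (𝓡 n) (f • X) Y =
      f • mlieBracket (𝓡 n) X Y - (fun x ↦ mvfderiv (𝓡 n) f x (Y x)) • X := by
  ext1 x
  refine (mlieBracket_smul_left (hf.mdifferentiable (by simp) x) (hX.mdifferentiableAt x)).trans ?_
  simp only [Pi.sub_apply, Pi.smul_apply']
  module

lemma mlieBracket_add_right_field (hY : IsSmoothField Y) (hZ : IsSmoothField Z) :
    mlieBracket (𝓡 n) X (Y + Z) = mlieBracket (𝓡 n) X Y + mlieBracket (𝓡 n) X Z := by
  ext1 x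
  exact mlieBracket_add_right (hY.mdifferentiableAt x) (hZ.mdifferentiableAt x)

lemma mlieBracket_add_left_field (hX : IsSmoothField X) (hY : IsSmoothField X') :
    mlieBracket (𝓡 n) (X + X') Y = mlieBracket (𝓡 n) X Y + mlieBracket (𝓡 n) X' Y := by
  ext1 x
  exact mlieBracket_add_left (hX.mdifferentiableAt x) (hY.mdifferentiableAt x)

lemma jacobi_mlieBracket (hX : IsSmoothField X) (hY : IsSmoothField Y) (hZ : IsSmoothField Z) :
    mlieBracket (𝓡 n) X (mlieBracket (𝓡 n) Y Z) =
      mlieBracket (𝓡 n) (mlieBracket (𝓡 n) X Y) Z +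
        mlieBracket (𝓡 n) Y (mlieBracket (𝓡 n) X Z) := by
  have h : minSmoothness ℝ 2 ≤ (∞ : ℕ∞ω) := by simpa using ENat.LEInfty.out
  exact leibniz_identity_mlieBracket (hX.of_le h) (hY.of_le h) (hZ.of_le h)

/-- The Lie bracket acts on functions as the commutator of the derivations. -/
lemma mvfderiv_mlieBracket [T2Space M] {f : M → ℝ} (hf : ContMDiff (𝓡 n) 𝓘(ℝ) ∞ f)
    (hX : IsSmoothField X) (hY : IsSmoothField Y) (x : M) :
    mvfderiv (𝓡 n) f x (mlieBracket (𝓡 n) X Y x) =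
      mvfderiv (𝓡 n) (fun y ↦ mvfderiv (𝓡 n) f y (Y y)) x (X x)
        - mvfderiv (𝓡 n) (fun y ↦ mvfderiv (𝓡 n) f y (X y)) x (Y x) := by
  by_cases hw : ∃ w : TangentSpace (𝓡 n) x, w ≠ 0
  · obtain ⟨w, hw⟩ := hw
    have hW := isSmoothField_smoothExtend w
    set W := smoothExtend w with hWdef
    have hXf := hX.contMDiff_mvfderiv hf
    have hYf := hY.contMDiff_mvfderiv hf
    -- The Jacobi identity for X, Y, fW minus f times that for X, Y, W leaves the desired identity
    -- as the coefficient of W, which is nonzero at x.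
    have J := jacobi_mlieBracket hX hY (hW.smul hf)
    have J0 := jacobi_mlieBracket hX hY hW
    rw [mlieBracket_smul_right_field hf hW, mlieBracket_smul_right_field hf hW,
      mlieBracket_smul_right_field hf hW,
      mlieBracket_add_right_field (hW.smul hYf) ((hY.mlieBracket hW).smul hf),
      mlieBracket_add_right_field (hW.smul hXf) ((hX.mlieBracket hW).smul hf),
      mlieBracket_smul_right_field hYf hW, mlieBracket_smul_right_field hXf hW,
      mlieBracket_smul_right_field hf (hY.mlieBracket hW),
      mlieBracket_smul_right_field hf (hX.mlieBracket hW), J0] at J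
    have Jx := congrFun J x
    simp only [Pi.add_apply, Pi.smul_apply'] at Jx
    have hWx : W x = w := smoothExtend_self w
    rw [hWx] at Jx
    have : (mvfderiv (𝓡 n) f x (mlieBracket (𝓡 n) X Y x) -
      (mvfderiv (𝓡 n) (fun y ↦ mvfderiv (𝓡 n) f y (Y y)) x (X x)
        - mvfderiv (𝓡 n) (fun y ↦ mvfderiv (𝓡 n) f y (X y)) x (Y x))) • w = 0 := by
      rw [sub_smul, sub_smul]
      rw [← sub_eq_zero] at Jx
      rw [← neg_eq_zero, ← Jx]
      module
    exact sub_eq_zero.1 ((smul_eq_zero.1 this).resolve_right hw)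
  · push Not at hw
    rw [hw (mlieBracket (𝓡 n) X Y x), hw (X x), hw (Y x)]
    simp

end LieBracket

variable {D : AffineConnection n M} {X Y Z : VecField n M}

/-- In the first two slots the derivatives of f cancel against the bracket term. In the last slot
what remains is X(Yf) - Y(Xf) - [X, Y]f, which vanishes by `mvfderiv_mlieBracket`. -/
lemma isTensorField_curvatureTensor [T2Space M] (hD : D.ContMDiffCovariantDerivative ∞) :
    IsTensorField (curvatureTensor D) where
  smooth {Y} hY := by
    refine .sub (.sub ?_ ?_) ?_
    · exact .covAlong hD (hY 0) (.covAlong hD (hY 1) (hY 2))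
    · exact .covAlong hD (hY 1) (.covAlong hD (hY 0) (hY 2))
    · exact .covAlong hD (.mlieBracket (hY 0) (hY 1)) (hY 2)
  add {Y} i {Z Z'} hY hZ hZ' := by
    fin_cases i
    · simp only [curvatureTensor, curvatureField, Function.update]
      simp [covAlong_add_left, mlieBracket_add_left_field hZ hZ',
        covAlong_add_right D (.covAlong hD hZ (hY 2)) (.covAlong hD hZ' (hY 2))]
      abel
    · simp only [curvatureTensor, curvatureField, Function.update]
      simp [covAlong_add_left, mlieBracket_add_right_field hZ hZ',
        covAlong_add_right D (.covAlong hD hZ (hY 2)) (.covAlong hD hZ' (hY 2))]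
      abel
    · simp only [curvatureTensor, curvatureField, Function.update]
      simp [covAlong_add_right D hZ hZ',
        covAlong_add_right D (.covAlong hD (hY 0) hZ) (.covAlong hD (hY 0) hZ'),
        covAlong_add_right D (.covAlong hD (hY 1) hZ) (.covAlong hD (hY 1) hZ')]
      abel
  smul {Y} i {f Z} hY hf hZ := by
    fin_cases i
    · simp only [curvatureTensor, curvatureField, Function.update]
      simp [covAlong_smul_left, mlieBracket_smul_left_field hf hZ, covAlong_sub_left,
        covAlong_smul_right D hf (.covAlong hD hZ (hY 2))]
      simp only [smul_sub]
      abel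
    · simp only [curvatureTensor, curvatureField, Function.update]
      simp [covAlong_smul_left, mlieBracket_smul_right_field hf hZ, covAlong_add_left,
        covAlong_smul_right D hf (.covAlong hD hZ (hY 2))]
      simp only [smul_sub]
      abel
    · simp only [curvatureTensor, curvatureField, Function.update]
      have h0 := (hY 0).contMDiff_mvfderiv hf
      have h1 := (hY 1).contMDiff_mvfderiv hf
      have hZ0 := IsSmoothField.covAlong hD (hY 0) hZ
      have hZ1 := IsSmoothField.covAlong hD (hY 1) hZ
      simp [covAlong_smul_right D hf hZ, covAlong_add_right D (hZ0.smul hf) (hZ.smul h0),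
        covAlong_add_right D (hZ1.smul hf) (hZ.smul h1), covAlong_smul_right D hf hZ0,
        covAlong_smul_right D hf hZ1, covAlong_smul_right D h0 hZ, covAlong_smul_right D h1 hZ]
      ext1 x
      simp only [Pi.add_apply, Pi.sub_apply, Pi.smul_apply', mvfderiv_mlieBracket hf (hY 0) (hY 1)]
      module

end Curvature

/-! ### The operators 𝓡_k(v) on tangent spaces and their derivatives. -/

section JacobiOperators

variable {n : ℕ} {M : Type*} [TopologicalSpace M] [ChartedSpace (EuclideanSpace ℝ (Fin n)) M]
  [IsManifold (𝓡 n) ∞ M] [T2Space M] {D : AffineConnection n M}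

/-- A linear functional of the chart, normalized on the image of v, does this near x; a bump
function makes it global. -/
lemma exists_contMDiff_mvfderiv_eq_one {x : M} {v : TangentSpace (𝓡 n) x} (hv : v ≠ 0) :
    ∃ f : M → ℝ, ContMDiff (𝓡 n) 𝓘(ℝ) ∞ f ∧ f x = 0 ∧ mvfderiv (𝓡 n) f x v = 1 := by
  let φ := extChartAt (𝓡 n) x
  have hinv : (mfderiv (𝓡 n) 𝓘(ℝ, EuclideanSpace ℝ (Fin n)) φ x).IsInvertible :=
    isInvertible_mfderiv_extChartAt (mem_extChartAt_source x)
  let L : EuclideanSpace ℝ (Fin n) := mfderiv (𝓡 n) 𝓘(ℝ, EuclideanSpace ℝ (Fin n)) φ x v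
  have hL : L ≠ 0 := fun h ↦ hv (hinv.injective (by rw [map_zero]; exact h))
  let ℓ : EuclideanSpace ℝ (Fin n) →L[ℝ] ℝ := (‖L‖ ^ 2)⁻¹ • innerSL ℝ L
  have hℓ : ℓ L = 1 := by
    have : ‖L‖ ≠ 0 := norm_ne_zero_iff.2 hL
    simp [ℓ, this]
  let g : M → ℝ := fun y ↦ ℓ (φ y) - ℓ (φ x)
  have hφ : ContMDiffOn (𝓡 n) 𝓘(ℝ, EuclideanSpace ℝ (Fin n)) ∞ φ (chartAt _ x).source :=
    contMDiffOn_extChartAt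
  have hg : ContMDiffOn (𝓡 n) 𝓘(ℝ) ∞ g (chartAt _ x).source :=
    (ℓ.contMDiff.comp_contMDiffOn hφ).sub contMDiffOn_const
  obtain ⟨b⟩ := (inferInstance : Nonempty (SmoothBumpFunction (𝓡 n) x))
  refine ⟨fun y ↦ b y • g y, b.contMDiff_smul hg, by simp [g], ?_⟩
  have h1 : (fun y ↦ b y • g y) =ᶠ[𝓝 x] g := by
    filter_upwards [b.eventuallyEq_one] with y hy
    simp [hy]
  have h2 : mvfderiv (𝓡 n) (fun y ↦ b y • g y) x = mvfderiv (𝓡 n) g x := by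
    simp only [mvfderiv, h1.mfderiv_eq]
    congr!
  rw [h2]
  have h3 : HasMFDerivAt (𝓡 n) 𝓘(ℝ, EuclideanSpace ℝ (Fin n)) φ x
      (mfderiv (𝓡 n) 𝓘(ℝ, EuclideanSpace ℝ (Fin n)) φ x) :=
    (mdifferentiableAt_extChartAt (mem_chart_source _ x)).hasMFDerivAt
  have h4 : HasMFDerivAt 𝓘(ℝ, EuclideanSpace ℝ (Fin n)) 𝓘(ℝ) (fun e ↦ ℓ e - ℓ (φ x)) (φ x) ℓ :=
    (ℓ.hasFDerivAt.sub_const _).hasMFDerivAt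
  have h5 := (h4.comp x h3).mfderiv
  have h6 : mfderiv (𝓡 n) 𝓘(ℝ) g x v = ℓ L := by
    change mfderiv (𝓡 n) 𝓘(ℝ) ((fun e ↦ ℓ e - ℓ (φ x)) ∘ φ) x v = _
    rw [h5]
    rfl
  exact h6.trans hℓ

/-- Every tangent vector at `x` extends to a smooth vector field whose covariant derivative at `x`
in a given direction vanishes. -/
lemma exists_isSmoothField_cov_eq_zero (D : AffineConnection n M) {x : M}
    (v w : TangentSpace (𝓡 n) x) :
    ∃ W : VecField n M, IsSmoothField W ∧ W x = w ∧ D W x v = 0 := by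
  rcases eq_or_ne v 0 with rfl | hv
  · exact ⟨smoothExtend w, isSmoothField_smoothExtend w, smoothExtend_self w, by simp⟩
  obtain ⟨f, hf, hfx, hfv⟩ := exists_contMDiff_mvfderiv_eq_one hv
  have hW := isSmoothField_smoothExtend w
  have hZ := isSmoothField_smoothExtend (D (smoothExtend w) x v)
  -- Since f vanishes at x and has derivative 1 along v, the correction leaves the value at x alone
  -- and cancels the covariant derivative.
  refine ⟨smoothExtend w + -(f • smoothExtend (D (smoothExtend w) x v)), hW.add (hZ.smul hf).neg,
    by simp [hfx], ?_⟩
  have h1 := congrFun (covAlong_add_right D (X := smoothExtend v) hW (hZ.smul hf).neg) x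
  rw [covAlong_neg_right D (hZ.smul hf), covAlong_smul_right D hf hZ] at h1
  simp only [covAlong, smoothExtend_self, Pi.add_apply, Pi.neg_apply, Pi.smul_apply', hfx,
    hfv] at h1
  rw [h1]
  simp

omit [T2Space M] in
-- An integral curve suffices in place of a geodesic, because only first derivatives at time 0 are
-- ever taken.
lemma exists_curve_hasDerivAt {X : VecField n M} (hX : IsSmoothField X) (x : M) :
    ∃ γ : ℝ → M, γ 0 = x ∧ ContinuousAt γ 0 ∧ ∀ f : M → ℝ, MDifferentiableAt (𝓡 n) 𝓘(ℝ) f x →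
      HasDerivAt (f ∘ γ) (mvfderiv (𝓡 n) f x (X x)) 0 := by
  obtain ⟨γ, hγ, h⟩ := exists_isMIntegralCurveAt_of_contMDiffAt_boundaryless (I := 𝓡 n) 0
    ((hX.of_le (n := ∞) (m := 1) ENat.LEInfty.out) x)
  have h0 := h.hasMFDerivAt
  refine ⟨γ, hγ, h0.continuousAt, fun f hf ↦ ?_⟩
  subst hγ
  have h1 : HasFDerivAt (f ∘ γ) ((mvfderiv (𝓡 n) f (γ 0)).comp
      ((1 : ℝ →L[ℝ] ℝ).smulRight (X (γ 0)))) 0 :=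
    (hf.hasMFDerivAt.comp 0 h0).hasFDerivAt
  simpa using h1.hasDerivAt

lemma isTensorField_iterCovDeriv_curvature (hD : D.ContMDiffCovariantDerivative ∞) (k : ℕ) :
    IsTensorField (iterCovDeriv D (curvatureTensor D) k) :=
  (isTensorField_curvatureTensor hD).iterCovDeriv hD k

/-- The endomorphism `𝓡_k(v)` of the tangent space. -/
def jacobiOperator (hD : D.ContMDiffCovariantDerivative ∞) (k : ℕ) {x : M}
    (v : TangentSpace (𝓡 n) x) : TangentSpace (𝓡 n) x →ₗ[ℝ] TangentSpace (𝓡 n) x :=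
  ((isTensorField_iterCovDeriv_curvature hD k).toMultilinear x).toLinearMap (fun _ ↦ v)
    ⟨k, by omega⟩

omit [T2Space M] in
lemma symCurvature_args_smooth {X U : VecField n M} (hX : IsSmoothField X) (hU : IsSmoothField U)
    (k m : ℕ) (i : Fin m) : IsSmoothField (if (i : ℕ) = k then U else X) := by
  split_ifs <;> assumption

lemma IsSmoothField.symCurvature (hD : D.ContMDiffCovariantDerivative ∞) {X U : VecField n M}
    (hX : IsSmoothField X) (hU : IsSmoothField U) (k : ℕ) :
    IsSmoothField (symCurvature D k X U) :=
  (isTensorField_iterCovDeriv_curvature hD k).smooth (symCurvature_args_smooth hX hU k _)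

lemma symCurvature_apply (hD : D.ContMDiffCovariantDerivative ∞) {X U : VecField n M}
    (hX : IsSmoothField X) (hU : IsSmoothField U) (k : ℕ) (x : M) :
    symCurvature D k X U x = jacobiOperator hD k (X x) (U x) := by
  have h := (isTensorField_iterCovDeriv_curvature hD k).toMultilinear_apply
    (symCurvature_args_smooth hX hU k _) x
  rw [symCurvature, ← h, jacobiOperator, MultilinearMap.toLinearMap_apply]
  congr 1
  ext1 i
  by_cases hi : (i : ℕ) = k
  · have : i = ⟨k, by omega⟩ := Fin.ext hi
    rw [this]
    simp
  · have : i ≠ ⟨k, by omega⟩ := fun h ↦ hi (congrArg Fin.val h)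
    simp [hi, this]

/-- Of the k + 3 slots of ∇^k R, all but one contain v. -/
lemma jacobiOperator_smul (hD : D.ContMDiffCovariantDerivative ∞) (k : ℕ) {x : M} (c : ℝ)
    (v : TangentSpace (𝓡 n) x) :
    jacobiOperator hD k (c • v) = c ^ (k + 2) • jacobiOperator hD k v := by
  ext1 u
  simp only [jacobiOperator, MultilinearMap.toLinearMap_apply, LinearMap.smul_apply]
  set L := (isTensorField_iterCovDeriv_curvature hD k).toMultilinear x
  set i : Fin (3 + k) := ⟨k, by omega⟩
  have h := L.map_smul_univ (Function.update (fun _ ↦ c) i 1) (Function.update (fun _ ↦ v) i u)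
  have h1 : (fun j ↦ Function.update (fun _ ↦ c) i 1 j • Function.update (fun _ ↦ v) i u j) =
      Function.update (fun _ ↦ c • v) i u := by
    ext1 j
    rcases eq_or_ne j i with rfl | hj
    · simp
    · simp [hj]
  rw [h1, Finset.prod_update_of_mem (Finset.mem_univ i)] at h
  rw [h]
  simp only [Finset.prod_const, one_mul]
  congr 2
  rw [Finset.card_sdiff]
  simp
  omega

/-- Differentiating `𝓡_k(X) U` along a field `X` with `∇_X X = 0` at the point in question. -/
lemma covAlong_symCurvature (hD : D.ContMDiffCovariantDerivative ∞) {X U : VecField n M}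
    (hX : IsSmoothField X) (hU : IsSmoothField U) (k : ℕ) {x : M} (hXX : covAlong D X X x = 0) :
    covAlong D X (symCurvature D k X U) x =
      symCurvature D (k + 1) X U x + symCurvature D k X (covAlong D X U) x := by
  have hT := isTensorField_iterCovDeriv_curvature hD k
  let Y : Fin (3 + k) → VecField n M := fun i ↦ if (i : ℕ) = k then U else X
  have hY : ∀ i, IsSmoothField (Y i) := symCurvature_args_smooth hX hU k _
  let i₀ : Fin (3 + k) := ⟨k, by omega⟩
  have h1 : symCurvature D (k + 1) X U =
      covDerivTensor D (iterCovDeriv D (curvatureTensor D) k) (Fin.cons X Y) := by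
    change covDerivTensor D (iterCovDeriv D (curvatureTensor D) k) _ = _
    congr 1
    ext1 i
    cases i using Fin.cases with
    | zero => simp
    | succ j => simp [Y]
  rw [h1, covDerivTensor_cons, ← Finset.add_sum_erase _ _ (Finset.mem_univ i₀)]
  -- Every slot other than that of U contributes a term with ∇_X X inserted, which is zero at x.
  have h2 : ∑ i ∈ Finset.univ.erase i₀, iterCovDeriv D (curvatureTensor D) k
      (Function.update Y i (covAlong D X (Y i))) x = 0 := by
    refine Finset.sum_eq_zero fun i hi ↦ ?_
    have hik : (i : ℕ) ≠ k := fun h ↦ Finset.ne_of_mem_erase hi (Fin.ext h)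
    refine hT.eq_zero_of_eq_zero hY i (.covAlong hD hX (hY i)) ?_
    simpa [Y, hik] using hXX
  have h3 : Function.update Y i₀ (covAlong D X (Y i₀)) =
      fun i : Fin (3 + k) ↦ if (i : ℕ) = k then covAlong D X U else X := by
    ext1 i
    rcases eq_or_ne i i₀ with rfl | hi
    · simp [Y, i₀]
    · have hik : (i : ℕ) ≠ k := fun h ↦ hi (Fin.ext h)
      simp [Y, hi, hik]
  rw [h3, Pi.sub_apply, Pi.add_apply, Finset.sum_apply, h2]
  simp [symCurvature, Y]

end JacobiOperators

/-! ### The maximum principle on compact sets of sequences to which the shift is tangent. -/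

section ShiftFlow

/-- The set `S` of real sequences is compact and the shift is a tangent vector field of `S`. -/
structure IsShiftFlow (S : Set (ℕ → ℝ)) : Prop where
  compact : IsCompact S
  tangent : ∀ y ∈ S, ∃ c : ℝ → ℕ → ℝ, c 0 = y ∧ (∀ᶠ t in 𝓝 0, c t ∈ S) ∧
    ∀ k, HasDerivAt (fun t ↦ c t k) (y (k + 1)) 0

/-- The pairing `∑ qₖ yₖ` of a polynomial `q` with a sequence `y`. -/
def seqPairing (y : ℕ → ℝ) : ℂ[X] →ₗ[ℂ] ℂ :=
  Polynomial.lsum fun k ↦ LinearMap.mulRight ℂ ((y k : ℝ) : ℂ)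

lemma seqPairing_eq_sum (y : ℕ → ℝ) (q : ℂ[X]) :
    seqPairing y q = ∑ k ∈ q.support, q.coeff k * (y k : ℂ) := by
  simp [seqPairing, Polynomial.lsum_apply, Polynomial.sum]

@[simp]
lemma seqPairing_C_mul_X_pow (y : ℕ → ℝ) (a : ℂ) (k : ℕ) :
    seqPairing y (C a * X ^ k) = a * y k := by
  rw [C_mul_X_pow_eq_monomial, seqPairing, Polynomial.lsum_apply, Polynomial.sum_monomial_index] <;>
    simp

@[simp]
lemma seqPairing_X_pow (y : ℕ → ℝ) (k : ℕ) : seqPairing y (X ^ k) = y k := by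
  simpa using seqPairing_C_mul_X_pow y 1 k

lemma seqPairing_C_mul (y : ℕ → ℝ) (a : ℂ) (q : ℂ[X]) :
    seqPairing y (C a * q) = a * seqPairing y q := by
  rw [← smul_eq_C_mul, map_smul, smul_eq_mul]

lemma continuous_seqPairing (q : ℂ[X]) : Continuous fun y : ℕ → ℝ ↦ seqPairing y q := by
  simp only [seqPairing_eq_sum]
  fun_prop

/-- Multiplication by X is dual to the shift, so it computes derivatives along the flow. -/
lemma hasDerivAt_seqPairing {c : ℝ → ℕ → ℝ} {y : ℕ → ℝ}
    (h : ∀ k, HasDerivAt (fun t ↦ c t k) (y (k + 1)) 0) (q : ℂ[X]) :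
    HasDerivAt (fun t ↦ seqPairing (c t) q) (seqPairing y (X * q)) 0 := by
  induction q using Polynomial.induction_on' with
  | add p q hp hq => simpa [mul_add] using! hp.add hq
  | monomial k a =>
    have h1 : X * monomial k a = C a * X ^ (k + 1) := by
      rw [← C_mul_X_pow_eq_monomial]; ring
    rw [h1, ← C_mul_X_pow_eq_monomial]
    simp only [seqPairing_C_mul_X_pow]
    exact ((h k).ofReal_comp).const_mul a

namespace IsShiftFlow

variable {S : Set (ℕ → ℝ)}

lemma seqPairing_X_mul (hS : IsShiftFlow S) {q : ℂ[X]} (hq : ∀ y ∈ S, seqPairing y q = 0) :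
    ∀ y ∈ S, seqPairing y (X * q) = 0 := by
  intro y hy
  obtain ⟨c, -, hcS, hc⟩ := hS.tangent y hy
  refine (hasDerivAt_seqPairing hc q).unique ?_
  refine (hasDerivAt_const (0 : ℝ) (0 : ℂ)).congr_of_eventuallyEq ?_
  filter_upwards [hcS] with t ht using hq _ ht

/-- The maximum principle: the derivative of a function vanishes at a maximum on `S`. -/
lemma exists_max (hS : IsShiftFlow S) (hne : S.Nonempty) {Φ : (ℕ → ℝ) → ℝ} (hΦ : Continuous Φ)
    {Φ' : (ℕ → ℝ) → ℝ}
    (hΦ' : ∀ (c : ℝ → ℕ → ℝ) (y : ℕ → ℝ), c 0 = y →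
      (∀ k, HasDerivAt (fun t ↦ c t k) (y (k + 1)) 0) → HasDerivAt (fun t ↦ Φ (c t)) (Φ' y) 0) :
    ∃ y ∈ S, (∀ z ∈ S, Φ z ≤ Φ y) ∧ Φ' y = 0 := by
  obtain ⟨y, hy, hmax⟩ := hS.compact.exists_isMaxOn hne hΦ.continuousOn
  refine ⟨y, hy, fun z hz ↦ hmax hz, ?_⟩
  obtain ⟨c, hc0, hcS, hc⟩ := hS.tangent y hy
  refine IsLocalMax.hasDerivAt_eq_zero (f := fun t ↦ Φ (c t)) ?_ (hΦ' c y hc0 hc)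
  filter_upwards [hcS] with t ht
  rw [hc0]
  exact hmax ht

/-- The derivative of |q(y)|² is 2 Re μ |q(y)|². It vanishes at a maximum, so the maximum itself is
0. -/
lemma seqPairing_eq_zero_of_re_ne_zero (hS : IsShiftFlow S) {μ : ℂ} (hμ : μ.re ≠ 0) {q : ℂ[X]}
    (hq : ∀ y ∈ S, seqPairing y ((X - C μ) * q) = 0) : ∀ y ∈ S, seqPairing y q = 0 := by
  intro y hy
  obtain ⟨z, hz, hmax, h0⟩ := hS.exists_max ⟨y, hy⟩
    (Φ := fun y ↦ ‖seqPairing y q‖ ^ 2)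
    (Φ' := fun y ↦ 2 * inner ℝ (seqPairing y q) (seqPairing y (X * q)))
    ((continuous_seqPairing q).norm.pow 2) (by
      intro c y hc0 hc
      have := (hasDerivAt_seqPairing hc q).norm_sq
      simpa [hc0] using this)
  have h1 := hq z hz
  rw [sub_mul, map_sub, seqPairing_C_mul, sub_eq_zero] at h1
  rw [h1] at h0
  set a := seqPairing z q
  have h2 : μ.re * ‖a‖ ^ 2 = 0 := by
    have : inner ℝ a (μ * a) = μ.re * ‖a‖ ^ 2 := by
      rw [Complex.inner, ← Complex.normSq_eq_norm_sq, Complex.normSq_apply]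
      simp
      ring
    linarith
  have h3 : ‖a‖ ^ 2 = 0 := (mul_eq_zero.1 h2).resolve_left hμ
  have h4 : ‖seqPairing y q‖ ^ 2 ≤ 0 := h3 ▸ hmax y hy
  exact norm_eq_zero.1 (pow_eq_zero_iff two_ne_zero |>.1 (le_antisymm h4 (by positivity)))

/-- An integrated flow would show linear growth of ⟨q, r⟩ along an orbit with |r|² constant. Only
tangency is available, so a penalty confines the maximum of ⟨q, r⟩ to the vicinity of the level |r|²
= κ. -/
lemma seqPairing_eq_zero_of_sq (hS : IsShiftFlow S) {μ : ℂ} (hμ : μ.re = 0) {q : ℂ[X]}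
    (hq : ∀ y ∈ S, seqPairing y ((X - C μ) * ((X - C μ) * q)) = 0) :
    ∀ y ∈ S, seqPairing y ((X - C μ) * q) = 0 := by
  intro y hy
  set r := (X - C μ) * q with hr
  by_contra hne
  set κ : ℝ := ‖seqPairing y r‖ ^ 2 with hκ
  have hκ0 : 0 < κ := by positivity
  have hXr : ∀ y ∈ S, seqPairing y (X * r) = μ * seqPairing y r := fun z hz ↦ by
    have h1 := hq z hz
    rwa [sub_mul, map_sub, seqPairing_C_mul, sub_eq_zero] at h1
  have hXq : ∀ y, seqPairing y (X * q) = μ * seqPairing y q + seqPairing y r := fun z ↦ by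
    rw [hr, sub_mul, map_sub, seqPairing_C_mul]; ring
  have hcont : Continuous fun y ↦ inner ℝ (seqPairing y q) (seqPairing y r) :=
    (continuous_seqPairing q).inner (continuous_seqPairing r)
  obtain ⟨B, hB⟩ : ∃ B : ℝ, ∀ z ∈ S, |inner ℝ (seqPairing z q) (seqPairing z r)| ≤ B := by
    obtain ⟨B, hB⟩ := hS.compact.exists_bound_of_continuousOn hcont.continuousOn
    exact ⟨B, hB⟩
  have hB0 : 0 ≤ B := (abs_nonneg _).trans (hB y hy)
  -- Chosen so that ε B < κ²: a point with r = 0 has the value -κ², which is then below the value at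
  -- y.
  set ε : ℝ := κ ^ 2 / (2 * B + 1) with hε
  have hε0 : 0 < ε := by positivity
  -- The penalty is stationary along the flow because Re μ = 0, so the derivative is ε|r|² and r
  -- vanishes at the maximum.
  obtain ⟨z, hz, hmax, h0⟩ := hS.exists_max ⟨y, hy⟩
    (Φ := fun y ↦ ε * inner ℝ (seqPairing y q) (seqPairing y r) - (‖seqPairing y r‖ ^ 2 - κ) ^ 2)
    (Φ' := fun y ↦ ε * (inner ℝ (seqPairing y q) (seqPairing y (X * r))
        + inner ℝ (seqPairing y (X * q)) (seqPairing y r))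
      - 2 * (‖seqPairing y r‖ ^ 2 - κ) * (2 * inner ℝ (seqPairing y r) (seqPairing y (X * r))))
    ((hcont.const_mul ε).sub ((((continuous_seqPairing r).norm.pow 2).sub continuous_const).pow 2))
    (by
      intro c y hc0 hc
      have h1 := hasDerivAt_seqPairing hc q
      have h2 := hasDerivAt_seqPairing hc r
      have := ((h1.inner ℝ h2).const_mul ε).sub ((h2.norm_sq.sub_const κ).pow 2)
      simpa [hc0] using! this)
  rw [hXr z hz, hXq] at h0
  set a := seqPairing z q
  set b := seqPairing z r
  have h1 : inner ℝ a (μ * b) + inner ℝ (μ * a + b) b = ‖b‖ ^ 2 := by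
    rw [← Complex.normSq_eq_norm_sq, Complex.normSq_apply]
    simp [Complex.inner, hμ]
    ring
  have h2 : inner ℝ b (μ * b) = 0 := by
    simp [Complex.inner, hμ]
    ring
  rw [h1, h2] at h0
  have h3 : ‖b‖ ^ 2 = 0 := by
    have : ε * ‖b‖ ^ 2 = 0 := by linarith
    exact (mul_eq_zero.1 this).resolve_left hε0.ne'
  have h4 := hmax y hy
  have hb : b = 0 := norm_eq_zero.1 (pow_eq_zero_iff two_ne_zero |>.1 h3)
  rw [hb, inner_zero_right, norm_zero, ← hκ] at h4
  have h5 := (abs_le.1 (hB y hy)).1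
  have h6 : ε * (-B) ≤ ε * inner ℝ (seqPairing y q) (seqPairing y r) :=
    mul_le_mul_of_nonneg_left h5 hε0.le
  have h7 : ε * (2 * B + 1) = κ ^ 2 := by rw [hε]; field_simp
  have h8 := mul_nonneg hε0.le hB0
  nlinarith

end IsShiftFlow

end ShiftFlow

/-! ### Degree and coefficients of the Jacobi polynomial. -/

section JacobiPolynomial

lemma degree_jacobiPolynomial_tail_lt (d : ℕ) (a : ℕ → ℝ) :
    (∑ i ∈ Finset.Icc 1 ((d + 1) / 2), C (a (2 * i)) * X ^ (d + 1 - 2 * i) : ℝ[X]).degree <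
      ((d + 1 : ℕ) : WithBot ℕ) := by
  refine (Polynomial.degree_sum_le _ _).trans_lt ((Finset.sup_lt_iff (WithBot.bot_lt_coe _)).2 ?_)
  intro i hi
  refine (degree_C_mul_X_pow_le _ _).trans_lt ?_
  have := Finset.mem_Icc.1 hi
  exact_mod_cast (by omega : d + 1 - 2 * i < d + 1)

lemma monic_jacobiPolynomial (d : ℕ) (a : ℕ → ℝ) : (jacobiPolynomial d a).Monic :=
  monic_X_pow_add (degree_jacobiPolynomial_tail_lt d a)

lemma natDegree_jacobiPolynomial (d : ℕ) (a : ℕ → ℝ) :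
    (jacobiPolynomial d a).natDegree = d + 1 := by
  refine natDegree_eq_of_degree_eq_some ?_
  rw [jacobiPolynomial, degree_add_eq_left_of_degree_lt, degree_X_pow]
  rw [degree_X_pow]
  exact degree_jacobiPolynomial_tail_lt d a

lemma coeff_jacobiPolynomial (d : ℕ) (a : ℕ → ℝ) {i : ℕ} (hi : i ∈ Finset.Icc 1 ((d + 1) / 2)) :
    (jacobiPolynomial d a).coeff (d + 1 - 2 * i) = a (2 * i) := by
  have hi' := Finset.mem_Icc.1 hi
  rw [jacobiPolynomial, coeff_add, coeff_X_pow, if_neg (by omega), zero_add, finsetSum_coeff,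
    Finset.sum_eq_single i]
  · simp
  · intro j hj hji
    have hj' := Finset.mem_Icc.1 hj
    rw [coeff_C_mul_X_pow, if_neg (by omega)]
  · exact fun h ↦ absurd hi h

lemma jacobiPolynomial_zero (a : ℕ → ℝ) : jacobiPolynomial 0 a = X := by
  simp [jacobiPolynomial]

lemma seqPairing_jacobiPolynomial (y : ℕ → ℝ) (d : ℕ) (a : ℕ → ℝ) :
    seqPairing y ((jacobiPolynomial d a).map (algebraMap ℝ ℂ)) =
      ((y (d + 1) + ∑ i ∈ Finset.Icc 1 ((d + 1) / 2), a (2 * i) * y (d + 1 - 2 * i) : ℝ) : ℂ) := by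
  simp [jacobiPolynomial, Polynomial.map_add, Polynomial.map_sum]

end JacobiPolynomial

/-! ### From monic annihilators to Jacobi relations, and the roots of a minimal one. -/

section Annihilator

lemma sum_range_one_add_neg_one_pow (f : ℕ → ℝ) (N : ℕ) :
    ∑ j ∈ Finset.range N, (1 + (-1) ^ j) * f j =
      2 * ∑ i ∈ Finset.range ((N + 1) / 2), f (2 * i) := by
  induction N with
  | zero => simp
  | succ N ih =>
    rw [Finset.sum_range_succ, ih]
    rcases Nat.even_or_odd' N with ⟨k, rfl | rfl⟩
    · rw [show (2 * k + 1 + 1) / 2 = k + 1 by omega, show (2 * k + 1) / 2 = k by omega,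
        Finset.sum_range_succ]
      simp; ring
    · rw [show (2 * k + 1 + 1 + 1) / 2 = k + 1 by omega,
        show (2 * k + 1 + 1) / 2 = k + 1 by omega]
      simp [pow_succ]

variable {S : Set (ℕ → ℝ)} (hsign : ∀ y ∈ S, (fun k ↦ (-1) ^ k * y k) ∈ S)
  (hflow : ∀ y ∈ S, ∃ S' ⊆ S, IsShiftFlow S' ∧ y ∈ S')

include hsign in
/-- The real part of the parity part of a monic annihilating polynomial is a Jacobi polynomial. -/
lemma exists_jacobiPolynomial_seqPairing_eq_zero {Q : ℂ[X]} (hQ : Q.Monic) {e : ℕ}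
    (hdeg : Q.natDegree = e + 1) (hann : ∀ y ∈ S, seqPairing y Q = 0) :
    ∃ a : ℕ → ℝ, ∀ y ∈ S, seqPairing y ((jacobiPolynomial e a).map (algebraMap ℝ ℂ)) = 0 := by
  refine ⟨fun j ↦ (Q.coeff (e + 1 - j)).re, fun y hy ↦ ?_⟩
  rw [seqPairing_jacobiPolynomial, Complex.ofReal_eq_zero]
  have key : ∀ y ∈ S, ∑ j ∈ Finset.range (e + 2), (Q.coeff (e + 1 - j)).re * y (e + 1 - j) = 0 := by
    intro y hy
    have h := congrArg Complex.re (hann y hy)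
    rw [seqPairing_eq_sum, ← Polynomial.sum_def (f := fun k a ↦ a * (y k : ℂ)),
      Polynomial.sum_over_range' _ (fun _ ↦ zero_mul _) (e + 2) (by omega), Complex.re_sum,
      ← Finset.sum_range_reflect] at h
    simpa using h
  have h1 := key y hy
  have h2 := key _ (hsign y hy)
  have h3 := sum_range_one_add_neg_one_pow
    (fun j ↦ (Q.coeff (e + 1 - j)).re * y (e + 1 - j)) (e + 2)
  -- Adding (-1)^(e+1) times the relation for the reflected sequence removes the terms with odd j,
  -- which are those of the wrong parity.
  have h4 : ∑ j ∈ Finset.range (e + 2), (1 + (-1) ^ j) *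
      ((Q.coeff (e + 1 - j)).re * y (e + 1 - j)) = 0 := by
    simp only [add_mul, one_mul, Finset.sum_add_distrib, h1, zero_add]
    have h5 : ∀ j ∈ Finset.range (e + 2), (-1) ^ j * ((Q.coeff (e + 1 - j)).re * y (e + 1 - j)) =
        (-1) ^ (e + 1) * ((Q.coeff (e + 1 - j)).re * ((-1) ^ (e + 1 - j) * y (e + 1 - j))) := by
      intro j hj
      have hj' : j ≤ e + 1 := by have := Finset.mem_range.1 hj; omega
      obtain ⟨m, hm⟩ := Nat.exists_eq_add_of_le hj'
      have : e + 1 - j = m := by omega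
      rw [this, hm, pow_add]
      have : ((-1 : ℝ) ^ m) * (-1) ^ m = 1 := by rw [← mul_pow]; simp
      linear_combination (-(-1) ^ j * (Q.coeff m).re * y m) * this
    rw [Finset.sum_congr rfl h5, ← Finset.mul_sum, h2, mul_zero]
  rw [h4, show (e + 2 + 1) / 2 = (e + 1) / 2 + 1 by omega, Finset.sum_range_eq_add_Ico _ (by omega)]
    at h3
  have h6 : (Q.coeff (e + 1)).re = 1 := by
    have : Q.coeff (e + 1) = 1 := by rw [← hdeg]; exact hQ
    simp [this]
  simp only [mul_zero, Nat.sub_zero, h6, one_mul] at h3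
  change _ + ∑ i ∈ Finset.Ico 1 ((e + 1) / 2 + 1), _ = _
  linarith

variable {d : ℕ} {a : ℕ → ℝ}
  (hann : ∀ y ∈ S, seqPairing y ((jacobiPolynomial d a).map (algebraMap ℝ ℂ)) = 0)
  (hmin : ∀ d' a', (∀ y ∈ S, seqPairing y ((jacobiPolynomial d' a').map (algebraMap ℝ ℂ)) = 0) →
    d ≤ d')

include hsign hflow hmin in
-- An annihilator of positive degree e + 1 ≤ d would give a relation of order e < d. The annihilator
-- 1 means y_0 = 0 throughout; one differentiation gives y_1 = 0, a relation of order 0.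
lemma eq_zero_of_monic_seqPairing_eq_zero {Q : ℂ[X]} (hQ : Q.Monic) (hdeg : Q.natDegree ≤ d)
    (hann : ∀ y ∈ S, seqPairing y Q = 0) : d = 0 := by
  rcases h : Q.natDegree with _ | e
  · rw [Polynomial.eq_one_of_monic_natDegree_zero hQ h] at hann
    refine Nat.le_zero.1 (hmin 0 0 fun y hy ↦ ?_)
    obtain ⟨S', hS', hS'flow, hy'⟩ := hflow y hy
    rw [jacobiPolynomial_zero, Polynomial.map_X]
    simpa using hS'flow.seqPairing_X_mul (q := 1) (fun z hz ↦ hann z (hS' hz)) y hy'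
  · obtain ⟨a', ha'⟩ := exists_jacobiPolynomial_seqPairing_eq_zero hsign hQ h hann
    have := hmin e a' ha'
    omega

include hsign hflow hann hmin in
-- For a forbidden root z, the maximum principle shows that P / (X - z), of degree d, is still an
-- annihilator. This forces d = 0 and P = X, whose only root is simple and imaginary.
theorem isRoot_jacobiPolynomial {z : ℂ}
    (hz : ((jacobiPolynomial d a).map (algebraMap ℝ ℂ)).IsRoot z) :
    z.re = 0 ∧ ((jacobiPolynomial d a).map (algebraMap ℝ ℂ)).rootMultiplicity z = 1 := by
  set P := (jacobiPolynomial d a).map (algebraMap ℝ ℂ) with hP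
  have hPm : P.Monic := (monic_jacobiPolynomial d a).map _
  have hPd : P.natDegree = d + 1 := by
    rw [hP, (monic_jacobiPolynomial d a).natDegree_map, natDegree_jacobiPolynomial]
  obtain ⟨Q, hQ⟩ := dvd_iff_isRoot.2 hz
  have hQm : Q.Monic := (monic_X_sub_C z).of_mul_monic_left (hQ ▸ hPm)
  have hQd : Q.natDegree = d := by
    have := (monic_X_sub_C z).natDegree_mul hQm
    rw [← hQ, hPd, natDegree_X_sub_C] at this
    omega
  have hre : z.re = 0 := by
    by_contra hre
    have hd : d = 0 := eq_zero_of_monic_seqPairing_eq_zero hsign hflow hmin hQm hQd.le fun y hy ↦ by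
      obtain ⟨S', hS', hS'flow, hy'⟩ := hflow y hy
      exact hS'flow.seqPairing_eq_zero_of_re_ne_zero hre
        (fun w hw ↦ by rw [← hQ]; exact hann w (hS' hw)) y hy'
    subst hd
    rw [hP, jacobiPolynomial_zero, Polynomial.map_X, IsRoot.def, eval_X] at hz
    simp [hz] at hre
  refine ⟨hre, le_antisymm ?_ ((rootMultiplicity_pos hPm.ne_zero).2 hz)⟩
  by_contra hlt
  have h2 : (X - C z) ^ 2 ∣ P := (le_rootMultiplicity_iff hPm.ne_zero).1 (by omega)
  obtain ⟨Q', hQ'⟩ := h2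
  have hQQ' : Q = (X - C z) * Q' := by
    refine mul_left_cancel₀ (X_sub_C_ne_zero z) ?_
    rw [← hQ, hQ']; ring
  have hd : d = 0 := eq_zero_of_monic_seqPairing_eq_zero hsign hflow hmin hQm hQd.le fun y hy ↦ by
    obtain ⟨S', hS', hS'flow, hy'⟩ := hflow y hy
    rw [hQQ']
    exact hS'flow.seqPairing_eq_zero_of_sq hre
      (fun w hw ↦ by rw [← hQQ', ← hQ]; exact hann w (hS' hw)) y hy'
  have h3 := natDegree_le_of_dvd (p := (X - C z) ^ 2) ⟨Q', hQ'⟩ hPm.ne_zero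
  rw [natDegree_pow, natDegree_X_sub_C, hPd] at h3
  omega

end Annihilator

/-! ### Real polynomials with simple imaginary roots. -/

section ProductForm

/-- A real monic polynomial whose complex roots are simple and purely imaginary is a product of
factors `X ^ 2 + λ ^ 2` with pairwise distinct `λ > 0`, and possibly `X`. -/
theorem exists_eq_prod_of_imaginary_roots {P : ℝ[X]} (hP : P.Monic)
    (hroots : ∀ z : ℂ, (P.map (algebraMap ℝ ℂ)).IsRoot z →
      z.re = 0 ∧ (P.map (algebraMap ℝ ℂ)).rootMultiplicity z = 1) :
    ∃ lam : Fin (P.natDegree / 2) → ℝ, StrictMono lam ∧ (∀ l, 0 < lam l) ∧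
      ((P = ∏ l, (X ^ 2 + C (lam l ^ 2)) ∧ Even P.natDegree) ∨
        (P = X * ∏ l, (X ^ 2 + C (lam l ^ 2)) ∧ Odd P.natDegree)) := by
  classical
  set p := P.map (algebraMap ℝ ℂ) with hp
  have hpm : p.Monic := hP.map _
  set R := p.roots.toFinset with hR
  have hmem : ∀ z, z ∈ R ↔ p.IsRoot z := fun z ↦ by
    rw [hR, Multiset.mem_toFinset, mem_roots hpm.ne_zero]
  have hnodup : p.roots.Nodup := by
    rw [Multiset.nodup_iff_count_le_one]
    intro z
    rw [count_roots]
    by_cases hz : p.IsRoot z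
    · exact (hroots z hz).2.le
    · simp [rootMultiplicity_eq_zero hz]
  have hprod : p = ∏ z ∈ R, (X - C z) := by
    have h := (IsAlgClosed.splits p).eq_prod_roots_of_monic hpm
    rw [h, Finset.prod, hR, Multiset.toFinset_val, hnodup.dedup]
  have hconj : ∀ z ∈ R, -z ∈ R := by
    intro z hz
    have h := (hmem z).1 hz
    have hz0 := (hroots z h).1
    have : -z = (starRingEnd ℂ) z := Complex.ext (by simp [hz0]) (by simp)
    rw [hmem, this, IsRoot.def, hp, eval_map_algebraMap, aeval_conj, ← eval_map_algebraMap]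
    rw [IsRoot.def, hp] at h
    simp [h]
  set A : Finset ℝ := (R.filter fun z ↦ 0 < z.im).image Complex.im with hA
  have hApos : ∀ t ∈ A, 0 < t := by
    intro t ht
    obtain ⟨z, hz, rfl⟩ := Finset.mem_image.1 ht
    exact (Finset.mem_filter.1 hz).2
  have hAR : ∀ t ∈ A, (t * Complex.I : ℂ) ∈ R := by
    intro t ht
    obtain ⟨z, hz, rfl⟩ := Finset.mem_image.1 ht
    have hz' := (Finset.mem_filter.1 hz).1
    have : (z.im * Complex.I : ℂ) = z :=
      Complex.ext (by simp [(hroots z ((hmem z).1 hz')).1]) (by simp)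
    rwa [this]
  have hRA : ∀ z ∈ R, 0 < z.im → z.im ∈ A ∧ z = z.im * Complex.I := by
    intro z hz him
    exact ⟨Finset.mem_image.2 ⟨z, Finset.mem_filter.2 ⟨hz, him⟩, rfl⟩,
      Complex.ext (by simp [(hroots z ((hmem z).1 hz)).1]) (by simp)⟩
  clear_value A
  -- This set is empty or {0}, and decides whether the factor X occurs.
  set Z : Finset ℂ := R.filter fun z ↦ z = 0 with hZ
  have hRdecomp : R = (A.image (fun t : ℝ ↦ (t * Complex.I : ℂ)) ∪
      A.image (fun t : ℝ ↦ (-(t * Complex.I) : ℂ))) ∪ Z := by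
    ext z
    simp only [Finset.mem_union, Finset.mem_image, hZ, Finset.mem_filter]
    constructor
    · intro hz
      rcases lt_trichotomy z.im 0 with h | h | h
      · have := hRA (-z) (hconj z hz) (by simpa using h)
        exact Or.inl (Or.inr ⟨_, this.1, by rw [← this.2, neg_neg]⟩)
      · exact Or.inr ⟨hz, Complex.ext (hroots z ((hmem z).1 hz)).1 h⟩
      · have := hRA z hz h
        exact Or.inl (Or.inl ⟨_, this.1, this.2.symm⟩)
    · rintro ((⟨t, ht, rfl⟩ | ⟨t, ht, rfl⟩) | h)
      · exact hAR t ht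
      · exact hconj _ (hAR t ht)
      · exact h.1
  have hd1 : Disjoint (A.image (fun t : ℝ ↦ (t * Complex.I : ℂ)))
      (A.image (fun t : ℝ ↦ (-(t * Complex.I) : ℂ))) := by
    rw [Finset.disjoint_left]
    intro z hz hz'
    obtain ⟨s, hs, rfl⟩ := Finset.mem_image.1 hz
    obtain ⟨t, ht, h⟩ := Finset.mem_image.1 hz'
    have := congrArg Complex.im h
    simp at this
    linarith [hApos s hs, hApos t ht]
  have hd2 : Disjoint (A.image (fun t : ℝ ↦ (t * Complex.I : ℂ)) ∪
      A.image (fun t : ℝ ↦ (-(t * Complex.I) : ℂ))) Z := by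
    rw [Finset.disjoint_right]
    intro z hz hz'
    obtain rfl := (Finset.mem_filter.1 hz).2
    rcases Finset.mem_union.1 hz' with h | h <;> obtain ⟨t, ht, h⟩ := Finset.mem_image.1 h <;>
      have := congrArg Complex.im h <;> simp at this <;> linarith [hApos t ht]
  have hpA : p = (∏ t ∈ A, (X ^ 2 + C (t ^ 2)) : ℝ[X]).map (algebraMap ℝ ℂ) *
      ∏ z ∈ Z, (X - C z) := by
    rw [hprod, hRdecomp, Finset.prod_union hd2, Finset.prod_union hd1, Finset.prod_image,
      Finset.prod_image, ← Finset.prod_mul_distrib, Polynomial.map_prod]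
    · congr 1
      refine Finset.prod_congr rfl fun t _ ↦ ?_
      have h1 : (C (t ^ 2 : ℝ)).map (algebraMap ℝ ℂ) = -(C (t * Complex.I : ℂ)) ^ 2 := by
        rw [← C_pow, mul_pow, Complex.I_sq]
        simp
      rw [Polynomial.map_add, h1]
      simp
      ring
    · intro s _ t _ h
      simpa using h
    · intro s _ t _ h
      simpa using h
  have hdegA : (∏ t ∈ A, (X ^ 2 + C (t ^ 2)) : ℝ[X]).natDegree = 2 * A.card := by
    rw [natDegree_prod_of_monic _ _ fun t _ ↦ monic_X_pow_add_C _ two_ne_zero]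
    simp only [natDegree_X_pow_add_C, Finset.sum_const, smul_eq_mul, mul_comm]
  have hcases : (P = ∏ t ∈ A, (X ^ 2 + C (t ^ 2)) ∧ P.natDegree = 2 * A.card) ∨
      (P = X * ∏ t ∈ A, (X ^ 2 + C (t ^ 2)) ∧ P.natDegree = 2 * A.card + 1) := by
    have hinj : Function.Injective (Polynomial.map (algebraMap ℝ ℂ)) :=
      map_injective _ (algebraMap ℝ ℂ).injective
    by_cases h0 : (0 : ℂ) ∈ R
    · have : Z = {0} := by
        ext z; simp only [hZ, Finset.mem_filter, Finset.mem_singleton]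
        exact ⟨fun h ↦ h.2, fun h ↦ ⟨h ▸ h0, h⟩⟩
      have h : P = X * ∏ t ∈ A, (X ^ 2 + C (t ^ 2)) := by
        apply hinj
        rw [← hp, hpA, this, Polynomial.map_mul, mul_comm]
        simp
      refine Or.inr ⟨h, ?_⟩
      rw [h, natDegree_X_mul (monic_prod_of_monic _ _ fun t _ ↦
        monic_X_pow_add_C _ two_ne_zero).ne_zero, hdegA]
    · have : Z = ∅ := by
        ext z; simp only [hZ, Finset.mem_filter, Finset.notMem_empty, iff_false]
        exact fun h ↦ h0 (h.2 ▸ h.1)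
      have h : P = ∏ t ∈ A, (X ^ 2 + C (t ^ 2)) := by
        apply hinj
        rw [← hp, hpA, this]
        simp
      exact Or.inl ⟨h, h ▸ hdegA⟩
  have hcard : A.card = P.natDegree / 2 := by
    rcases hcases with h | h <;> omega
  have hlam : ∏ l, (X ^ 2 + C (A.orderEmbOfFin hcard l ^ 2)) =
      (∏ t ∈ A, (X ^ 2 + C (t ^ 2)) : ℝ[X]) := by
    conv_rhs => rw [← Finset.map_orderEmbOfFin_univ A hcard]
    rw [Finset.prod_map]
    rfl
  refine ⟨A.orderEmbOfFin hcard, (A.orderEmbOfFin hcard).strictMono,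
    fun l ↦ hApos _ (A.orderEmbOfFin_mem hcard l), ?_⟩
  rw [hlam]
  rcases hcases with ⟨h, h'⟩ | ⟨h, h'⟩
  · exact Or.inl ⟨h, h' ▸ even_two_mul _⟩
  · exact Or.inr ⟨h, h' ▸ odd_two_mul_add_one _⟩

/-- Each new coefficient is q_(k-2) + c q_k. Nonnegativity of all coefficients is carried through
the induction because at the ends only one of the two summands is known to be positive. -/
lemma coeff_prod_X_sq_add_C {m : ℕ} {c : Fin m → ℝ} (hc : ∀ l, 0 < c l) :
    (∀ k, 0 ≤ (∏ l, (X ^ 2 + C (c l)) : ℝ[X]).coeff k) ∧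
      ∀ j ≤ m, 0 < (∏ l, (X ^ 2 + C (c l)) : ℝ[X]).coeff (2 * j) := by
  induction m with
  | zero =>
    refine ⟨fun k ↦ ?_, fun j hj ↦ ?_⟩
    · simp only [Finset.univ_eq_empty, Finset.prod_empty, coeff_one]
      split_ifs <;> simp
    · obtain rfl : j = 0 := by omega
      simp
  | succ m ih =>
    obtain ⟨ih1, ih2⟩ := ih (c := fun l ↦ c l.succ) fun l ↦ hc _
    rw [Fin.prod_univ_succ]
    set q : ℝ[X] := ∏ l : Fin m, (X ^ 2 + C (c l.succ))
    have h0 := hc 0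
    have hco : ∀ k, ((X ^ 2 + C (c 0)) * q).coeff k =
        (if 2 ≤ k then q.coeff (k - 2) else 0) + c 0 * q.coeff k := by
      intro k
      rw [add_mul, coeff_add, coeff_X_pow_mul', coeff_C_mul]
    refine ⟨fun k ↦ ?_, fun j hj ↦ ?_⟩
    · rw [hco]
      have := mul_nonneg h0.le (ih1 k)
      split_ifs
      · linarith [ih1 (k - 2)]
      · linarith
    · rw [hco]
      rcases Nat.lt_or_ge m j with h | h
      · have := mul_nonneg h0.le (ih1 (2 * j))
        rw [if_pos (by omega), show 2 * j - 2 = 2 * (j - 1) by omega]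
        linarith [ih2 (j - 1) (by omega)]
      · have := mul_pos h0 (ih2 j h)
        split_ifs
        · linarith [ih1 (2 * j - 2)]
        · linarith

lemma jacobiPolynomial_coeff_pos {d : ℕ} {a : ℕ → ℝ} {lam : Fin ((d + 1) / 2) → ℝ}
    (hpos : ∀ l, 0 < lam l)
    (h : (jacobiPolynomial d a = ∏ l, (X ^ 2 + C (lam l ^ 2)) ∧ Even (d + 1)) ∨
      (jacobiPolynomial d a = X * ∏ l, (X ^ 2 + C (lam l ^ 2)) ∧ Odd (d + 1)))
    {i : ℕ} (hi : i ∈ Finset.Icc 1 ((d + 1) / 2)) : 0 < a (2 * i) := by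
  have hi' := Finset.mem_Icc.1 hi
  have hc := (coeff_prod_X_sq_add_C (c := fun l ↦ lam l ^ 2) fun l ↦ pow_pos (hpos l) 2).2
    ((d + 1) / 2 - i) (by omega)
  rw [← coeff_jacobiPolynomial d a hi]
  rcases h with ⟨h, hd⟩ | ⟨h, hd⟩
  · obtain ⟨r, hr⟩ := hd
    rwa [h, show d + 1 - 2 * i = 2 * ((d + 1) / 2 - i) by omega]
  · obtain ⟨r, hr⟩ := hd
    rwa [h, show d + 1 - 2 * i = 2 * ((d + 1) / 2 - i) + 1 by omega, coeff_X_mul]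

end ProductForm

/-! ### Sequences of matrix coefficients and the tangency of the shift. -/

section Jets

variable {n : ℕ} {M : Type*} [TopologicalSpace M] [ChartedSpace (EuclideanSpace ℝ (Fin n)) M]
  [IsManifold (𝓡 n) ∞ M] [RiemannianBundle (fun x : M ↦ TangentSpace (𝓡 n) x)]
  [IsContMDiffRiemannianBundle (𝓡 n) ∞ (EuclideanSpace ℝ (Fin n))
    (fun x : M ↦ TangentSpace (𝓡 n) x)]

lemma IsSmoothField.inner {X Y : VecField n M} (hX : IsSmoothField X) (hY : IsSmoothField Y) :
    ContMDiff (𝓡 n) 𝓘(ℝ) ∞ (fun x ↦ inner ℝ (X x) (Y x)) :=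
  ContMDiff.inner_bundle (F := EuclideanSpace ℝ (Fin n)) hX hY

lemma mvfderiv_inner_field {D : AffineConnection n M} (hD : D.IsMetricCompatible)
    {Y Z : VecField n M} (hY : IsSmoothField Y) (hZ : IsSmoothField Z) (X : VecField n M) (x : M) :
    mvfderiv (𝓡 n) (fun y ↦ inner ℝ (Y y) (Z y)) x (X x) =
      inner ℝ (covAlong D X Y x) (Z x) + inner ℝ (Y x) (covAlong D X Z x) :=
  hD.mvfderiv_inner_eq X (hY.mdifferentiableAt x) (hZ.mdifferentiableAt x)

variable [T2Space M] {D : AffineConnection n M}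

/-- The sequence of the matrix coefficients `⟨𝓡_k(v) u, w⟩`. -/
def jetSeq (hD : D.ContMDiffCovariantDerivative ∞) {x : M} (v u w : TangentSpace (𝓡 n) x) :
    ℕ → ℝ :=
  fun k ↦ inner ℝ (jacobiOperator hD k v u) w

/-- The set of all sequences of matrix coefficients with respect to unit vectors. -/
def jetSet (hD : D.ContMDiffCovariantDerivative ∞) : Set (ℕ → ℝ) :=
  {y | ∃ (x : M) (v u w : TangentSpace (𝓡 n) x), ‖v‖ = 1 ∧ ‖u‖ = 1 ∧ ‖w‖ = 1 ∧ jetSeq hD v u w = y}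

omit [IsContMDiffRiemannianBundle (𝓡 n) ∞ (EuclideanSpace ℝ (Fin n))
    (fun x : M ↦ TangentSpace (𝓡 n) x)] in
lemma jetSeq_normalize (hD : D.ContMDiffCovariantDerivative ∞) {x : M}
    (v u w : TangentSpace (𝓡 n) x) (k : ℕ) :
    jetSeq hD (‖v‖⁻¹ • v) (‖u‖⁻¹ • u) (‖w‖⁻¹ • w) k =
      inner ℝ (jacobiOperator hD k v u) w / (‖v‖ ^ (k + 2) * ‖u‖ * ‖w‖) := by
  simp only [jetSeq, jacobiOperator_smul, map_smul, LinearMap.smul_apply, inner_smul_left,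
    inner_smul_right]
  simp
  field_simp

omit [IsContMDiffRiemannianBundle (𝓡 n) ∞ (EuclideanSpace ℝ (Fin n))
    (fun x : M ↦ TangentSpace (𝓡 n) x)] in
lemma jetSeq_normalize_mem (hD : D.ContMDiffCovariantDerivative ∞) {x : M}
    {v u w : TangentSpace (𝓡 n) x} (hv : v ≠ 0) (hu : u ≠ 0) (hw : w ≠ 0) :
    jetSeq hD (‖v‖⁻¹ • v) (‖u‖⁻¹ • u) (‖w‖⁻¹ • w) ∈ jetSet hD :=
  ⟨x, _, _, _, by simp [norm_smul, hv], by simp [norm_smul, hu], by simp [norm_smul, hw], rfl⟩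

omit [IsContMDiffRiemannianBundle (𝓡 n) ∞ (EuclideanSpace ℝ (Fin n))
    (fun x : M ↦ TangentSpace (𝓡 n) x)] in
lemma jetSet_sign (hD : D.ContMDiffCovariantDerivative ∞) :
    ∀ y ∈ jetSet hD, (fun k ↦ (-1) ^ k * y k) ∈ jetSet hD := by
  rintro y ⟨x, v, u, w, hv, hu, hw, rfl⟩
  refine ⟨x, -v, u, w, by simpa using hv, hu, hw, ?_⟩
  ext1 k
  have := jacobiOperator_smul hD k (-1) v
  rw [neg_one_smul] at this
  rw [jetSeq, this, LinearMap.smul_apply, inner_smul_left]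
  simp [pow_add, jetSeq]

lemma hasDerivAt_norm_of_inner {E : ℝ → ℝ} {N : ℝ → ℝ} (hN : ∀ t, N t = √(E t))
    (h0 : N 0 = 1) (hE : HasDerivAt E 0 0) : HasDerivAt N 0 0 := by
  have h1 : E 0 ≠ 0 := fun h ↦ by simp [hN, h] at h0
  have h2 := hE.sqrt h1
  rw [zero_div] at h2
  exact h2.congr_of_eventuallyEq (Filter.Eventually.of_forall hN)

/-- Normalizing is invisible to first order when the norms equal 1 and are stationary. -/
lemma hasDerivAt_div_of_unit {F N₁ N₂ N₃ : ℝ → ℝ} {F' : ℝ} (k : ℕ) (hF : HasDerivAt F F' 0)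
    (h₁ : HasDerivAt N₁ 0 0) (h₂ : HasDerivAt N₂ 0 0) (h₃ : HasDerivAt N₃ 0 0)
    (e₁ : N₁ 0 = 1) (e₂ : N₂ 0 = 1) (e₃ : N₃ 0 = 1) :
    HasDerivAt (fun t ↦ F t / (N₁ t ^ k * N₂ t * N₃ t)) F' 0 := by
  have h := hF.div (((h₁.pow k).mul h₂).mul h₃) (by simp [e₁, e₂, e₃])
  simpa [e₁, e₂, e₃] using! h

omit [T2Space M] in
/-- The derivative of `‖X‖` along a curve with initial velocity `X x`. -/
lemma hasDerivAt_norm_comp (hDm : D.IsMetricCompatible) {X W : VecField n M}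
    (hW : IsSmoothField W) {γ : ℝ → M} (hWX : covAlong D X W (γ 0) = 0) (h1 : ‖W (γ 0)‖ = 1)
    (hγ : ∀ f : M → ℝ, MDifferentiableAt (𝓡 n) 𝓘(ℝ) f (γ 0) →
      HasDerivAt (f ∘ γ) (mvfderiv (𝓡 n) f (γ 0) (X (γ 0))) 0) :
    HasDerivAt (fun t ↦ ‖W (γ t)‖) 0 0 := by
  have h := hγ _ ((hW.inner hW).mdifferentiable (by simp) (γ 0))
  rw [mvfderiv_inner_field hDm hW hW, hWX] at h
  simp only [inner_zero_left, inner_zero_right, add_zero] at h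
  exact hasDerivAt_norm_of_inner (fun t ↦ norm_eq_sqrt_real_inner _) h1 h

/-- The vectors are extended by fields X, U, W with vanishing covariant derivative along v at x, and
followed along an integral curve of X. Metric compatibility then leaves only ⟨𝓡_(k+1)(X)U, W⟩ in the
derivative. Away from x the fields need not be unit, hence the normalization. -/
lemma jetSet_tangent (hD : D.ContMDiffCovariantDerivative ∞) (hDm : D.IsMetricCompatible) :
    ∀ y ∈ jetSet hD, ∃ c : ℝ → ℕ → ℝ, c 0 = y ∧ (∀ᶠ t in 𝓝 0, c t ∈ jetSet hD) ∧
      ∀ k, HasDerivAt (fun t ↦ c t k) (y (k + 1)) 0 := by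
  rintro y ⟨x, v, u, w, hv, hu, hw, rfl⟩
  obtain ⟨X, hX, hXx, hDX⟩ := exists_isSmoothField_cov_eq_zero D v v
  obtain ⟨U, hU, hUx, hDU⟩ := exists_isSmoothField_cov_eq_zero D v u
  obtain ⟨W, hW, hWx, hDW⟩ := exists_isSmoothField_cov_eq_zero D v w
  obtain ⟨γ, hγ0, -, hγ⟩ := exists_curve_hasDerivAt hX x
  subst hγ0
  subst hXx hUx hWx
  have nX := hasDerivAt_norm_comp hDm hX hDX hv hγ
  have nU := hasDerivAt_norm_comp hDm hU hDU hu hγ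
  have nW := hasDerivAt_norm_comp hDm hW hDW hw hγ
  have ne {N : ℝ → ℝ} (h : HasDerivAt N 0 0) (h1 : N 0 = 1) : ∀ᶠ t in 𝓝 0, N t ≠ 0 :=
    h.continuousAt.eventually_ne (by simp [h1])
  refine ⟨fun t ↦ jetSeq hD (‖X (γ t)‖⁻¹ • X (γ t)) (‖U (γ t)‖⁻¹ • U (γ t))
    (‖W (γ t)‖⁻¹ • W (γ t)), by simp [hv, hu, hw], ?_, fun k ↦ ?_⟩
  · filter_upwards [ne nX hv, ne nU hu, ne nW hw] with t h1 h2 h3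
    exact jetSeq_normalize_mem hD (norm_ne_zero_iff.1 h1) (norm_ne_zero_iff.1 h2)
      (norm_ne_zero_iff.1 h3)
  · simp only [jetSeq_normalize, ← symCurvature_apply hD hX hU]
    refine hasDerivAt_div_of_unit (k + 2) ?_ nX nU nW hv hu hw
    have hR := hX.symCurvature hD hU k
    have h := hγ _ ((hR.inner hW).mdifferentiable (by simp) (γ 0))
    rw [mvfderiv_inner_field hDm hR hW, covAlong_symCurvature hD hX hU k hDX,
      symCurvature_apply hD hX (.covAlong hD hX hU), show covAlong D X U (γ 0) = 0 from hDU,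
      show covAlong D X W (γ 0) = 0 from hDW, map_zero, add_zero, inner_zero_right, add_zero,
      symCurvature_apply hD hX hU] at h
    exact h

end Jets

/-! ### Compactness of the set of jets over a compact manifold. -/

section Compactness

variable {n : ℕ} {M : Type*} [TopologicalSpace M] [ChartedSpace (EuclideanSpace ℝ (Fin n)) M]
  [IsManifold (𝓡 n) ∞ M] [RiemannianBundle (fun x : M ↦ TangentSpace (𝓡 n) x)]
  [IsContMDiffRiemannianBundle (𝓡 n) ∞ (EuclideanSpace ℝ (Fin n))
    (fun x : M ↦ TangentSpace (𝓡 n) x)] {D : AffineConnection n M}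

/-- The vector field with constant coefficients `c` in the frame `E`. -/
def frameCombination (E : Fin n → VecField n M) (c : Fin n → ℝ) : VecField n M :=
  ∑ i, c i • E i

omit [IsManifold (𝓡 n) ∞ M] [RiemannianBundle (fun x : M ↦ TangentSpace (𝓡 n) x)]
  [IsContMDiffRiemannianBundle (𝓡 n) ∞ (EuclideanSpace ℝ (Fin n))
    (fun x : M ↦ TangentSpace (𝓡 n) x)] in
lemma frameCombination_apply (E : Fin n → VecField n M) (c : Fin n → ℝ) (x : M) :
    frameCombination E c x = ∑ i, c i • E i x := by
  simp only [frameCombination, Finset.sum_apply]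
  rfl

lemma continuous_norm_frameCombination {E : Fin n → VecField n M}
    (hE : ∀ i, IsSmoothField (E i)) :
    Continuous fun p : M × (Fin n → ℝ) ↦ ‖frameCombination E p.2 p.1‖ := by
  have h : ∀ p : M × (Fin n → ℝ), ‖frameCombination E p.2 p.1‖ =
      √(∑ i, ∑ j, p.2 i * (p.2 j * inner ℝ (E i p.1) (E j p.1))) := by
    intro p
    rw [norm_eq_sqrt_real_inner, frameCombination_apply, sum_inner]
    congr 1
    refine Finset.sum_congr rfl fun i _ ↦ ?_
    rw [inner_smul_left, inner_sum, Finset.mul_sum]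
    refine Finset.sum_congr rfl fun j _ ↦ ?_
    rw [inner_smul_right]
    simp
  simp only [h]
  have hc : ∀ i j, Continuous fun p : M × (Fin n → ℝ) ↦ inner ℝ (E i p.1) (E j p.1) :=
    fun i j ↦ ((hE i).inner (hE j)).continuous.comp continuous_fst
  fun_prop

variable [T2Space M]

/-- Multilinearity expands the expression into a polynomial in the frame coefficients, whose own
coefficients are smooth functions on M. -/
lemma continuous_inner_jacobiOperator_frameCombination (hD : D.ContMDiffCovariantDerivative ∞)
    {E : Fin n → VecField n M} (hE : ∀ i, IsSmoothField (E i)) (k : ℕ) :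
    Continuous fun p : M × (Fin n → ℝ) × (Fin n → ℝ) × (Fin n → ℝ) ↦
      inner ℝ (jacobiOperator hD k (frameCombination E p.2.1 p.1) (frameCombination E p.2.2.1 p.1))
        (frameCombination E p.2.2.2 p.1) := by
  have hT := isTensorField_iterCovDeriv_curvature hD k
  let V : (Fin n → ℝ) × (Fin n → ℝ) × (Fin n → ℝ) → Fin (3 + k) → Fin n → ℝ :=
    fun q i ↦ if i = ⟨k, by omega⟩ then q.2.1 else q.1
  have h : ∀ p : M × (Fin n → ℝ) × (Fin n → ℝ) × (Fin n → ℝ),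
      inner ℝ (jacobiOperator hD k (frameCombination E p.2.1 p.1)
        (frameCombination E p.2.2.1 p.1)) (frameCombination E p.2.2.2 p.1) =
      ∑ r : Fin (3 + k) → Fin n, ∑ j, (∏ i, V p.2 i (r i)) * (p.2.2.2 j *
        inner ℝ (iterCovDeriv D (curvatureTensor D) k (fun i ↦ E (r i)) p.1) (E j p.1)) := by
    intro p
    have h1 : Function.update (fun _ ↦ frameCombination E p.2.1 p.1) ⟨k, by omega⟩
        (frameCombination E p.2.2.1 p.1) =
        fun i : Fin (3 + k) ↦ ∑ j, V p.2 i j • E j p.1 := by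
      ext1 i
      by_cases hi : i = ⟨k, by omega⟩
      · rw [hi]
        simp [V, frameCombination_apply]
      · simp [V, frameCombination_apply, hi]
    rw [jacobiOperator, MultilinearMap.toLinearMap_apply, h1, MultilinearMap.map_sum, sum_inner]
    refine Finset.sum_congr rfl fun r _ ↦ ?_
    rw [MultilinearMap.map_smul_univ, hT.toMultilinear_apply fun i ↦ hE (r i),
      frameCombination_apply, inner_sum]
    refine Finset.sum_congr rfl fun j _ ↦ ?_
    rw [inner_smul_left, inner_smul_right]
    simp
  simp only [h]
  have hc : ∀ (r : Fin (3 + k) → Fin n) j,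
      Continuous fun p : M × (Fin n → ℝ) × (Fin n → ℝ) × (Fin n → ℝ) ↦
        inner ℝ (iterCovDeriv D (curvatureTensor D) k (fun i ↦ E (r i)) p.1) (E j p.1) :=
    fun r j ↦ ((hT.smooth fun i ↦ hE (r i)).inner (hE j)).continuous.comp continuous_fst
  have hV : ∀ (r : Fin (3 + k) → Fin n) i,
      Continuous fun p : M × (Fin n → ℝ) × (Fin n → ℝ) × (Fin n → ℝ) ↦ V p.2 i (r i) := by
    intro r i
    simp only [V]
    split_ifs <;> fun_prop
  clear_value V
  refine continuous_finsetSum _ fun r _ ↦ continuous_finsetSum _ fun j _ ↦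
    (continuous_finsetProd _ fun i _ ↦ hV r i).mul (Continuous.mul (by fun_prop) (hc r j))

/-- Over a compact neighbourhood carrying a frame, unit vectors are normalized frame combinations,
so the jets are a continuous image of a compact product. -/
lemma exists_isCompact_jetSet_local [CompactSpace M] (hD : D.ContMDiffCovariantDerivative ∞)
    (x : M) :
    ∃ N ∈ 𝓝 x, ∃ K ⊆ jetSet hD, IsCompact K ∧ ∀ p ∈ N, ∀ v u w : TangentSpace (𝓡 n) p,
      ‖v‖ = 1 → ‖u‖ = 1 → ‖w‖ = 1 → jetSeq hD v u w ∈ K := by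
  obtain ⟨E, hE, hfr, -⟩ := exists_smooth_frame_coeff (n := n) x
  obtain ⟨s, hs, hfr⟩ := hfr.exists_mem
  obtain ⟨N, hN, hNs, hNc⟩ := local_compact_nhds hs
  have hne : ∀ p ∈ s, ∀ c : Fin n → ℝ, c ≠ 0 → frameCombination E c p ≠ 0 := by
    intro p hp c hc h
    rw [frameCombination_apply] at h
    exact hc (funext (Fintype.linearIndependent_iff.1 (hfr p hp).1 c h))
  -- This is the sphere of the supremum norm. It only has to be compact, avoid 0 and meet every ray,
  -- as the vectors are normalized afterwards.
  let B : Set (Fin n → ℝ) := Metric.sphere 0 1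
  have hB : ∀ c ∈ B, c ≠ 0 := fun c hc h ↦ by simp [B, h] at hc
  let f : M × (Fin n → ℝ) × (Fin n → ℝ) × (Fin n → ℝ) → ℕ → ℝ := fun p ↦
    jetSeq hD (‖frameCombination E p.2.1 p.1‖⁻¹ • frameCombination E p.2.1 p.1)
      (‖frameCombination E p.2.2.1 p.1‖⁻¹ • frameCombination E p.2.2.1 p.1)
      (‖frameCombination E p.2.2.2 p.1‖⁻¹ • frameCombination E p.2.2.2 p.1)
  have hBc : IsCompact B := isCompact_sphere 0 1
  refine ⟨N, hN, f '' (N ×ˢ B ×ˢ B ×ˢ B), ?_, ?_, ?_⟩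
  · rintro _ ⟨⟨p, c, b, e⟩, ⟨hp, hc, hb, he⟩, rfl⟩
    exact jetSeq_normalize_mem hD (hne p (hNs hp) c (hB c hc)) (hne p (hNs hp) b (hB b hb))
      (hne p (hNs hp) e (hB e he))
  · refine (hNc.prod (hBc.prod (hBc.prod hBc))).image_of_continuousOn ?_
    refine continuousOn_pi.2 fun k ↦ ?_
    simp only [f, jetSeq_normalize]
    have hn := continuous_norm_frameCombination hE
    have h1 := hn.comp (continuous_fst.prodMk (continuous_fst.comp continuous_snd) :
      Continuous fun p : M × (Fin n → ℝ) × (Fin n → ℝ) × (Fin n → ℝ) ↦ (p.1, p.2.1))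
    have h2 := hn.comp (continuous_fst.prodMk (continuous_fst.comp
      (continuous_snd.comp continuous_snd)) :
      Continuous fun p : M × (Fin n → ℝ) × (Fin n → ℝ) × (Fin n → ℝ) ↦ (p.1, p.2.2.1))
    have h3 := hn.comp (continuous_fst.prodMk (continuous_snd.comp
      (continuous_snd.comp continuous_snd)) :
      Continuous fun p : M × (Fin n → ℝ) × (Fin n → ℝ) × (Fin n → ℝ) ↦ (p.1, p.2.2.2))
    refine (continuous_inner_jacobiOperator_frameCombination hD hE k).continuousOn.div
      (((h1.pow (k + 2)).mul h2).mul h3).continuousOn ?_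
    rintro ⟨p, c, b, e⟩ ⟨hp, hc, hb, he⟩
    have g1 := hne p (hNs hp) c (hB c hc)
    have g2 := hne p (hNs hp) b (hB b hb)
    have g3 := hne p (hNs hp) e (hB e he)
    simp [g1, g2, g3]
  · intro p hp v u w hv hu hw
    have key : ∀ v : TangentSpace (𝓡 n) p, ‖v‖ = 1 → ∃ c ∈ B,
        ‖frameCombination E c p‖⁻¹ • frameCombination E c p = v := by
      intro v hv
      let bs := Module.Basis.mk (hfr p (hNs hp)).1 (hfr p (hNs hp)).2
      have h1 : frameCombination E (⇑(bs.repr v)) p = v := by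
        rw [frameCombination_apply]
        conv_rhs => rw [← bs.sum_repr v]
        simp [bs]
      set c : Fin n → ℝ := ⇑(bs.repr v)
      have hc : c ≠ 0 := by
        intro h
        rw [h, frameCombination_apply] at h1
        simp only [Pi.zero_apply, zero_smul, Finset.sum_const_zero] at h1
        simp [← h1] at hv
      have h2 : frameCombination E (‖c‖⁻¹ • c) p = ‖c‖⁻¹ • v := by
        conv_rhs => rw [← h1]
        simp only [frameCombination_apply, Finset.smul_sum, smul_smul, Pi.smul_apply, smul_eq_mul]
      refine ⟨‖c‖⁻¹ • c, by simp [B, norm_smul, hc], ?_⟩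
      rw [h2, norm_smul, hv, smul_smul]
      simp [hc]
    obtain ⟨c, hc, rfl⟩ := key v hv
    obtain ⟨b, hb, rfl⟩ := key u hu
    obtain ⟨e, he, rfl⟩ := key w hw
    exact ⟨(p, c, b, e), ⟨hp, hc, hb, he⟩, rfl⟩

lemma isCompact_jetSet [CompactSpace M] (hD : D.ContMDiffCovariantDerivative ∞) :
    IsCompact (jetSet hD) := by
  choose N hN K hK hKc h using exists_isCompact_jetSet_local hD
  obtain ⟨t, ht⟩ := CompactSpace.elim_nhds_subcover N hN
  have : jetSet hD = ⋃ x ∈ t, K x := by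
    refine subset_antisymm ?_ (Set.iUnion₂_subset fun x _ ↦ hK x)
    rintro y ⟨p, v, u, w, hv, hu, hw, rfl⟩
    have hp : p ∈ ⋃ x ∈ t, N x := ht ▸ Set.mem_univ p
    obtain ⟨x, hx, hp⟩ := Set.mem_iUnion₂.1 hp
    exact Set.mem_iUnion₂.2 ⟨x, hx, h x p hp v u w hv hu hw⟩
  rw [this]
  exact t.isCompact_biUnion fun x _ ↦ hKc x

lemma isShiftFlow_jetSet [CompactSpace M] (hD : D.ContMDiffCovariantDerivative ∞)
    (hDm : D.IsMetricCompatible) : IsShiftFlow (jetSet hD) where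
  compact := isCompact_jetSet hD
  tangent := jetSet_tangent hD hDm

end Compactness

/-! ### The tensor A = ∇' - ∇ and the comparison of curvatures. -/

section DifferenceOfConnections

variable {n : ℕ} {M : Type*} [TopologicalSpace M] [ChartedSpace (EuclideanSpace ℝ (Fin n)) M]
  [IsManifold (𝓡 n) ∞ M]

/-- The difference `∇'_X Y - ∇_X Y` of two connections. -/
def differenceField (D D' : AffineConnection n M) (X Y : VecField n M) : VecField n M :=
  covAlong D' X Y - covAlong D X Y

variable {D D' : AffineConnection n M} {X Y U V : VecField n M}

lemma differenceField_apply (hY : IsSmoothField Y) (x : M) :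
    differenceField D D' X Y x = D'.difference D x (Y x) (X x) := by
  have h := D'.isCovariantDerivativeOnUniv.difference_apply D.isCovariantDerivativeOnUniv
    (x := x) (σ := Y) (hσ := hY.mdifferentiableAt x)
  rw [CovariantDerivative.difference, h]
  rfl

lemma covAlong_eq_sub_differenceField :
    covAlong D X Y = covAlong D' X Y - differenceField D D' X Y := by
  rw [differenceField, sub_sub_cancel]

lemma IsSmoothField.differenceField (hD : D.ContMDiffCovariantDerivative ∞)
    (hD' : D'.ContMDiffCovariantDerivative ∞) (hX : IsSmoothField X) (hY : IsSmoothField Y) :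
    IsSmoothField (differenceField D D' X Y) :=
  (hX.covAlong hD' hY).sub (hX.covAlong hD hY)

/-- The difference tensor is alternating in its two arguments. -/
def IsAlternatingDifference (D D' : AffineConnection n M) : Prop :=
  ∀ (x : M) (u : TangentSpace (𝓡 n) x), D'.difference D x u u = 0

lemma IsAlternatingDifference.swap (h : IsAlternatingDifference D D') {x : M}
    (u v : TangentSpace (𝓡 n) x) : D'.difference D x u v = -D'.difference D x v u := by
  have h1 := h x (u + v)
  simp only [map_add, add_apply, h x u, h x v] at h1
  rw [eq_neg_iff_add_eq_zero]
  simpa [add_comm] using h1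

/-- With A alternating and ∇ torsion-free, the torsion of ∇' is A_U V - A_V U = 2 A_U V; parallel
torsion thus means parallel A. -/
lemma torsionTensor_eq (h : IsAlternatingDifference D D') (hD : D.torsion = 0)
    {Y : Fin 2 → VecField n M} (hY : ∀ i, IsSmoothField (Y i)) :
    torsionTensor D' Y = (2 : ℝ) • differenceField D D' (Y 0) (Y 1) := by
  ext1 x
  have h0 := congr($hD x (Y 0 x) (Y 1 x))
  rw [D.torsion_apply ((hY 0).mdifferentiableAt x) ((hY 1).mdifferentiableAt x)] at h0
  rw [torsionTensor, D'.torsion_apply ((hY 0).mdifferentiableAt x) ((hY 1).mdifferentiableAt x)]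
  have h1 := differenceField_apply (D := D) (D' := D') (X := Y 0) (hY 1) x
  have h2 := differenceField_apply (D := D) (D' := D') (X := Y 1) (hY 0) x
  rw [h.swap, ← h1] at h2
  simp only [zero_apply, Pi.zero_apply] at h0
  change D' (Y 1) x (Y 0 x) - D' (Y 0) x (Y 1 x) - VectorField.mlieBracket (𝓡 n) (Y 0) (Y 1) x =
    (2 : ℝ) • (D' (Y 1) x (Y 0 x) - D (Y 1) x (Y 0 x))
  change D' (Y 0) x (Y 1 x) - D (Y 0) x (Y 1 x) = -(D' (Y 1) x (Y 0 x) - D (Y 1) x (Y 0 x)) at h2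
  rw [eq_add_of_sub_eq h2, eq_of_sub_eq_zero h0 |>.symm]
  module

/-- The difference tensor is parallel. -/
lemma covAlong_differenceField (hD : D.ContMDiffCovariantDerivative ∞)
    (hD' : D'.ContMDiffCovariantDerivative ∞) (h : IsAlternatingDifference D D')
    (hDt : D.torsion = 0) (hpar : IsParallelTensor D' (torsionTensor D'))
    (hX : IsSmoothField X) (hU : IsSmoothField U) (hV : IsSmoothField V) :
    covAlong D' X (differenceField D D' U V) =
      differenceField D D' (covAlong D' X U) V + differenceField D D' U (covAlong D' X V) := by
  have hY : ∀ i, IsSmoothField ((![U, V] : Fin 2 → VecField n M) i) := by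
    intro i; fin_cases i <;> assumption
  have hXU := hX.covAlong hD' hU
  have hXV := hX.covAlong hD' hV
  have h1 := hpar (Fin.cons X ![U, V]) (by
    intro i
    cases i using Fin.cases with
    | zero => exact hX
    | succ j => exact hY j)
  rw [covDerivTensor_cons, Fin.sum_univ_two] at h1
  rw [show (![U, V] : Fin 2 → VecField n M) 0 = U from rfl,
    show (![U, V] : Fin 2 → VecField n M) 1 = V from rfl,
    torsionTensor_eq h hDt hY, torsionTensor_eq h hDt (.update hY 0 hXU),
    torsionTensor_eq h hDt (.update hY 1 hXV)] at h1
  change covAlong D' X ((2 : ℝ) • differenceField D D' U V) -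
    ((2 : ℝ) • differenceField D D' (covAlong D' X U) V +
      (2 : ℝ) • differenceField D D' U (covAlong D' X V)) = 0 at h1
  rw [covAlong_const_smul_right _ _ (hU.differenceField hD hD' hV)] at h1
  have h2 : (2 : ℝ) • (covAlong D' X (differenceField D D' U V) -
      (differenceField D D' (covAlong D' X U) V +
        differenceField D D' U (covAlong D' X V))) = 0 := by
    rw [← h1, smul_sub, smul_add]
  have := (smul_eq_zero.1 h2).resolve_left two_ne_zero
  exact sub_eq_zero.1 this

/-- Writing ∇ = ∇' - A, the derivatives of A are absorbed by its parallelism and the bracket is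
expressed by ∇' and A. The relation A_X X = 0 removes the other quadratic terms. -/
lemma curvatureField_eq_add (hD : D.ContMDiffCovariantDerivative ∞)
    (hD' : D'.ContMDiffCovariantDerivative ∞) (h : IsAlternatingDifference D D')
    (hDt : D.torsion = 0) (hpar : IsParallelTensor D' (torsionTensor D'))
    (hX : IsSmoothField X) (hU : IsSmoothField U) :
    curvatureField D U X X =
      curvatureField D' U X X + differenceField D D' X (differenceField D D' U X) := by
  have hXX := hX.covAlong hD' hX
  have hUX := hU.covAlong hD' hX
  have hXU := hX.covAlong hD' hU
  have hA := hU.differenceField hD hD' hX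
  have hBr := hU.mlieBracket hX
  have hAXX : differenceField D D' X X = 0 := by
    ext1 x; rw [differenceField_apply hX, h]; rfl
  have h2 : VectorField.mlieBracket (𝓡 n) U X = covAlong D' U X - covAlong D' X U -
      (2 : ℝ) • differenceField D D' U X := by
    have := torsionTensor_eq h hDt (Y := ![U, X]) (by intro i; fin_cases i <;> assumption)
    ext1 x
    have h3 := congrFun this x
    rw [torsionTensor, D'.torsion_apply (by exact hU.mdifferentiableAt x)
      (by exact hX.mdifferentiableAt x)] at h3
    simp only [Matrix.cons_val_zero, Matrix.cons_val_one] at h3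
    rw [Pi.sub_apply, Pi.sub_apply, ← h3]
    simp only [covAlong]
    abel
  simp only [curvatureField]
  rw [covAlong_eq_sub_differenceField (D := D) (D' := D') (X := X) (Y := X), hAXX, sub_zero,
    covAlong_eq_sub_differenceField (D := D) (D' := D') (X := U) (Y := covAlong D' X X),
    covAlong_eq_sub_differenceField (D := D) (D' := D') (X := U) (Y := X),
    covAlong_eq_sub_differenceField (D := D) (D' := D') (X := X),
    covAlong_sub_right D' hUX hA, covAlong_differenceField hD hD' h hDt hpar hX hU hX,
    covAlong_eq_sub_differenceField (D := D) (D' := D') (Y := X)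
      (X := VectorField.mlieBracket (𝓡 n) U X)]
  ext1 x
  simp only [Pi.sub_apply, Pi.add_apply, differenceField_apply hXX, differenceField_apply hX,
    differenceField_apply hA, differenceField_apply (hUX.sub hA), h2, Pi.smul_apply, map_sub,
    map_smul, sub_apply]
  rw [h.swap (X x) (covAlong D' U X x), h.swap (X x) (D'.difference D x (X x) (U x))]
  module

end DifferenceOfConnections

/-! ### Shift flows generated by a skew-symmetric endomorphism. -/

section CommutatorFlow

variable {E : Type*} [NormedAddCommGroup E] [InnerProductSpace ℝ E]

lemma hasDerivAt_inner_affine (p q r s : E) :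
    HasDerivAt (fun t : ℝ ↦ inner ℝ (p + t • q) (r + t • s)) (inner ℝ q r + inner ℝ p s) 0 := by
  have h (p q : E) : HasDerivAt (fun t : ℝ ↦ p + t • q) q 0 := by
    simpa using ((hasDerivAt_id (0 : ℝ)).smul_const q).const_add p
  have := (h p q).inner ℝ (h r s)
  simpa [add_comm] using this

/-- If `J (k + 1)` is the commutator of `J k` with a skew-symmetric map, then the matrix
coefficients of the sequence `J` form a shift flow. -/
lemma isShiftFlow_of_commutator [FiniteDimensional ℝ E] {A : E →ₗ[ℝ] E} {J : ℕ → E →ₗ[ℝ] E}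
    (hA : ∀ u, inner ℝ (A u) u = 0) (hJ : ∀ k u, J (k + 1) u = J k (A u) - A (J k u)) :
    IsShiftFlow {y : ℕ → ℝ | ∃ u w, ‖u‖ = 1 ∧ ‖w‖ = 1 ∧ (fun k ↦ inner ℝ (J k u) w) = y} where
  compact := by
    have : ProperSpace E := FiniteDimensional.proper ℝ E
    have h : Continuous fun p : E × E ↦ (fun k ↦ inner ℝ (J k p.1) p.2 : ℕ → ℝ) :=
      continuous_pi fun k ↦ ((J k).continuous_of_finiteDimensional.comp continuous_fst).inner
        continuous_snd
    convert ((isCompact_sphere (0 : E) 1).prod (isCompact_sphere (0 : E) 1)).image h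
    ext y
    simp [and_assoc]
  tangent := by
    rintro y ⟨u, w, hu, hw, rfl⟩
    have hskew (u w : E) : inner ℝ (A u) w = -inner ℝ u (A w) := by
      have h := hA (u + w)
      simp only [map_add, inner_add_left, inner_add_right, hA] at h
      rw [real_inner_comm (A w) u]
      linarith
    have hN (u : E) (hu : ‖u‖ = 1) : HasDerivAt (fun t : ℝ ↦ ‖u + t • A u‖) 0 0 := by
      have h := hasDerivAt_inner_affine u (A u) u (A u)
      rw [real_inner_comm (A u) u, hA, add_zero] at h
      exact hasDerivAt_norm_of_inner (fun t ↦ norm_eq_sqrt_real_inner _) (by simpa) h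
    have ne {N : ℝ → ℝ} (h : HasDerivAt N 0 0) (h1 : N 0 = 1) : ∀ᶠ t in 𝓝 0, N t ≠ 0 :=
      h.continuousAt.eventually_ne (by simp [h1])
    refine ⟨fun t k ↦ inner ℝ (J k (‖u + t • A u‖⁻¹ • (u + t • A u)))
      (‖w + t • A w‖⁻¹ • (w + t • A w)), by simp [hu, hw], ?_, fun k ↦ ?_⟩
    · filter_upwards [ne (hN u hu) (by simpa), ne (hN w hw) (by simpa)] with t h1 h2
      refine ⟨_, _, ?_, ?_, rfl⟩
      · rw [norm_smul, norm_inv, norm_norm, inv_mul_cancel₀ h1]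
      · rw [norm_smul, norm_inv, norm_norm, inv_mul_cancel₀ h2]
    -- Only u and w move, so the first of the three norms is a dummy with exponent 0.
    · have h := hasDerivAt_div_of_unit 0 (hasDerivAt_inner_affine (J k u) (J k (A u)) w (A w))
        (hN u hu) (hN u hu) (hN w hw) (by simpa) (by simpa) (by simpa)
      have e : inner ℝ (J (k + 1) u) w = inner ℝ (J k (A u)) w + inner ℝ (J k u) (A w) := by
        rw [hJ, inner_sub_left, hskew]
        ring
      beta_reduce
      rw [e]
      refine h.congr_of_eventuallyEq (Filter.Eventually.of_forall fun t ↦ ?_)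
      simp only [map_smul, map_add, inner_smul_left, inner_smul_right]
      simp
      field_simp

end CommutatorFlow

/-! ### The commutator formula for 𝓡_k in the naturally reductive case. -/

section Transvection

variable {n : ℕ} {M : Type*} [TopologicalSpace M] [ChartedSpace (EuclideanSpace ℝ (Fin n)) M]
  [IsManifold (𝓡 n) ∞ M]

/-- Two smooth connections `D` and `D'` such that `D` is torsion-free, `D'` has parallel torsion
and parallel curvature, and the difference is alternating. -/
structure IsParallelPair (D D' : AffineConnection n M) : Prop where
  smooth : D.ContMDiffCovariantDerivative ∞
  smooth' : D'.ContMDiffCovariantDerivative ∞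
  alternating : IsAlternatingDifference D D'
  torsion_free : D.torsion = 0
  parallel_torsion : IsParallelTensor D' (torsionTensor D')
  parallel_curvature : IsParallelTensor D' (curvatureTensor D')

variable {D D' : AffineConnection n M} {X U V : VecField n M}

namespace IsParallelPair

lemma covAlong_differenceField_eq_zero (h : IsParallelPair D D') (hX : IsSmoothField X)
    (hU : IsSmoothField U) {x : M} (hXX : covAlong D' X X x = 0) (hXU : covAlong D' X U x = 0) :
    covAlong D' X (differenceField D D' X U) x = 0 := by
  rw [covAlong_differenceField h.smooth h.smooth' h.alternating h.torsion_free h.parallel_torsion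
    hX hX hU, Pi.add_apply, differenceField_apply hU, differenceField_apply
    (hX.covAlong h.smooth' hU), hXX, hXU]
  simp

variable [T2Space M]

/-- Here 𝓡_0(X) = 𝓡'_0(X) - A_X A_X, and both the curvature of ∇' and A are ∇'-parallel. -/
lemma covAlong_symCurvature_zero_eq_zero (h : IsParallelPair D D') (hX : IsSmoothField X)
    (hU : IsSmoothField U) {x : M} (hXX : covAlong D' X X x = 0) (hXU : covAlong D' X U x = 0) :
    covAlong D' X (symCurvature D 0 X U) x = 0 := by
  have hA := hX.differenceField h.smooth h.smooth' hU
  have h0 : symCurvature D 0 X U = symCurvature D' 0 X U -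
      differenceField D D' X (differenceField D D' X U) := by
    have h1 := curvatureField_eq_add h.smooth h.smooth' h.alternating h.torsion_free
      h.parallel_torsion hX hU
    change curvatureField D U X X = curvatureField D' U X X - _
    rw [h1, sub_eq_add_neg]
    congr 1
    ext1 x
    rw [Pi.neg_apply, differenceField_apply (hU.differenceField h.smooth h.smooth' hX),
      differenceField_apply hA, differenceField_apply hX, differenceField_apply hU,
      h.alternating.swap (X x) (U x), map_neg, neg_apply]
  have hR : symCurvature D' 1 X U = 0 :=
    h.parallel_curvature _ (by intro i; split_ifs <;> assumption)
  rw [h0, covAlong_sub_right D' (hX.symCurvature h.smooth' hU 0)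
    (hX.differenceField h.smooth h.smooth' hA), Pi.sub_apply,
    h.covAlong_differenceField_eq_zero hX hA hXX (h.covAlong_differenceField_eq_zero hX hU hXX hXU),
    covAlong_symCurvature h.smooth' hX hU 0 hXX, hR,
    symCurvature_apply h.smooth' hX (hX.covAlong h.smooth' hU), hXU]
  simp

/-- Extend v and u by fields that are ∇'-parallel along v at x. On such fields, and on 𝓡_k(X)U by
hypothesis, ∇_X acts as -A_X, so the product rule for ∇ becomes the commutator formula. -/
lemma jacobiOperator_succ_of_covAlong (h : IsParallelPair D D') {k : ℕ}
    (hk : ∀ {X U : VecField n M} {x : M}, IsSmoothField X → IsSmoothField U →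
      covAlong D' X X x = 0 → covAlong D' X U x = 0 → covAlong D' X (symCurvature D k X U) x = 0)
    {x : M} (v u : TangentSpace (𝓡 n) x) :
    jacobiOperator h.smooth (k + 1) v u = jacobiOperator h.smooth k v (D'.difference D x u v) -
      D'.difference D x (jacobiOperator h.smooth k v u) v := by
  obtain ⟨X, hX, rfl, hDX⟩ := exists_isSmoothField_cov_eq_zero D' v v
  obtain ⟨U, hU, rfl, hDU⟩ := exists_isSmoothField_cov_eq_zero D' (X x) u
  have hS := hX.symCurvature h.smooth hU k
  have e (Y : VecField n M) (hY : IsSmoothField Y) (h0 : covAlong D' X Y x = 0) :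
      covAlong D X Y x = -D'.difference D x (Y x) (X x) := by
    rw [covAlong_eq_sub_differenceField (D := D) (D' := D'), Pi.sub_apply, h0,
      differenceField_apply hY, zero_sub]
  have h1 := covAlong_symCurvature h.smooth hX hU k
    (by rw [e X hX hDX, h.alternating, neg_zero])
  rw [e _ hS (hk hX hU hDX hDU), symCurvature_apply h.smooth hX hU,
    symCurvature_apply h.smooth hX hU, symCurvature_apply h.smooth hX (hX.covAlong h.smooth hU),
    e U hU hDU, map_neg] at h1
  rw [← sub_eq_add_neg, eq_sub_iff_add_eq] at h1
  rw [← h1]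
  abel

/-- By induction: parallelism at level k holds at all points, so the commutator formula is an
identity of fields and can be differentiated to reach level k + 1. -/
lemma covAlong_symCurvature_eq_zero (h : IsParallelPair D D') (k : ℕ) :
    ∀ {X U : VecField n M} {x : M}, IsSmoothField X → IsSmoothField U →
      covAlong D' X X x = 0 → covAlong D' X U x = 0 →
      covAlong D' X (symCurvature D k X U) x = 0 := by
  induction k with
  | zero => exact fun hX hU ↦ h.covAlong_symCurvature_zero_eq_zero hX hU
  | succ k ih =>
    intro X U x hX hU hXX hXU
    have hS := hX.symCurvature h.smooth hU k
    have hA := hX.differenceField h.smooth h.smooth' hU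
    have h1 : symCurvature D (k + 1) X U = symCurvature D k X (differenceField D D' X U) -
        differenceField D D' X (symCurvature D k X U) := by
      ext1 y
      rw [Pi.sub_apply, symCurvature_apply h.smooth hX hU, symCurvature_apply h.smooth hX hA,
        differenceField_apply hS, differenceField_apply hU, symCurvature_apply h.smooth hX hU,
        h.jacobiOperator_succ_of_covAlong ih]
    rw [h1, covAlong_sub_right D' (hX.symCurvature h.smooth hA k)
      (hX.differenceField h.smooth h.smooth' hS), Pi.sub_apply,
      ih hX hA hXX (h.covAlong_differenceField_eq_zero hX hU hXX hXU),
      h.covAlong_differenceField_eq_zero hX hS hXX (ih hX hU hXX hXU), sub_zero]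

lemma jacobiOperator_succ (h : IsParallelPair D D') (k : ℕ) {x : M} (v u : TangentSpace (𝓡 n) x) :
    jacobiOperator h.smooth (k + 1) v u = jacobiOperator h.smooth k v (D'.difference D x u v) -
      D'.difference D x (jacobiOperator h.smooth k v u) v :=
  h.jacobiOperator_succ_of_covAlong (h.covAlong_symCurvature_eq_zero k) v u

end IsParallelPair

variable [T2Space M] [RiemannianBundle (fun x : M ↦ TangentSpace (𝓡 n) x)]

lemma IsParallelPair.exists_isShiftFlow (h : IsParallelPair D D')
    (hskew : ∀ (x : M) (v u : TangentSpace (𝓡 n) x), inner ℝ (D'.difference D x u v) u = 0)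
    {y : ℕ → ℝ} (hy : y ∈ jetSet h.smooth) :
    ∃ S ⊆ jetSet h.smooth, IsShiftFlow S ∧ y ∈ S := by
  obtain ⟨x, v, u, w, hv, hu, hw, rfl⟩ := hy
  let A : TangentSpace (𝓡 n) x →ₗ[ℝ] TangentSpace (𝓡 n) x :=
    { toFun u := D'.difference D x u v
      map_add' u u' := by simp
      map_smul' c u := by simp }
  refine ⟨_, ?_, isShiftFlow_of_commutator (A := A) (J := fun k ↦ jacobiOperator h.smooth k v)
    (hskew x v) (fun k u ↦ h.jacobiOperator_succ k v u), u, w, hu, hw, rfl⟩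
  rintro _ ⟨u, w, hu, hw, rfl⟩
  exact ⟨x, v, u, w, hv, hu, hw, rfl⟩

end Transvection

/-! ### Jacobi relations as annihilators of jets. -/

section Relation

variable {n : ℕ} {M : Type*} [TopologicalSpace M] [ChartedSpace (EuclideanSpace ℝ (Fin n)) M]
  [IsManifold (𝓡 n) ∞ M] [RiemannianBundle (fun x : M ↦ TangentSpace (𝓡 n) x)]
  [T2Space M] {D : AffineConnection n M} {d : ℕ} {a : ℕ → ℝ}

lemma isLinearJacobiRelation_iff (hD : D.ContMDiffCovariantDerivative ∞) :
    IsLinearJacobiRelation D d a ↔ ∀ (x : M) (v u : TangentSpace (𝓡 n) x),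
      jacobiOperator hD (d + 1) v u = -∑ i ∈ Finset.Icc 1 ((d + 1) / 2),
        (a (2 * i) * ‖v‖ ^ (2 * i)) • jacobiOperator hD (d + 1 - 2 * i) v u := by
  constructor
  · intro h x v u
    have := h (smoothExtend v) (smoothExtend u) (isSmoothField_smoothExtend v)
      (isSmoothField_smoothExtend u) x
    simpa only [symCurvature_apply hD (isSmoothField_smoothExtend v) (isSmoothField_smoothExtend u),
      smoothExtend_self] using this
  · intro h X U hX hU x
    simpa only [symCurvature_apply hD hX hU] using h x (X x) (U x)

lemma isLinearJacobiRelation_iff_jetSet (hD : D.ContMDiffCovariantDerivative ∞) :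
    IsLinearJacobiRelation D d a ↔
      ∀ y ∈ jetSet hD, seqPairing y ((jacobiPolynomial d a).map (algebraMap ℝ ℂ)) = 0 := by
  have key (x : M) (v u w : TangentSpace (𝓡 n) x) (hv : v ≠ 0) (hu : u ≠ 0) (hw : w ≠ 0) :
      seqPairing (jetSeq hD (‖v‖⁻¹ • v) (‖u‖⁻¹ • u) (‖w‖⁻¹ • w))
        ((jacobiPolynomial d a).map (algebraMap ℝ ℂ)) = 0 ↔
      inner ℝ (jacobiOperator hD (d + 1) v u) w = inner ℝ (-∑ i ∈ Finset.Icc 1 ((d + 1) / 2),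
        (a (2 * i) * ‖v‖ ^ (2 * i)) • jacobiOperator hD (d + 1 - 2 * i) v u) w := by
    have hv' := norm_ne_zero_iff.2 hv
    have hu' := norm_ne_zero_iff.2 hu
    have hw' := norm_ne_zero_iff.2 hw
    -- The common denominator: the leading term has degree d + 3 in v, and the factors ‖v‖^(2i)
    -- bring the others to the same degree.
    have hc : ‖v‖ ^ (d + 3) * ‖u‖ * ‖w‖ ≠ 0 := by positivity
    rw [seqPairing_jacobiPolynomial, Complex.ofReal_eq_zero, inner_neg_left, sum_inner,
      eq_neg_iff_add_eq_zero, ← mul_right_inj' hc, mul_zero, mul_add, Finset.mul_sum]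
    simp only [jetSeq_normalize, inner_smul_left]
    refine Eq.congr_left ?_
    congr 1
    · field_simp
    · refine Finset.sum_congr rfl fun i hi ↦ ?_
      have : d + 3 = (d + 1 - 2 * i + 2) + 2 * i := by
        have := Finset.mem_Icc.1 hi
        omega
      rw [this, pow_add ‖v‖ _ (2 * i)]
      simp only [conj_trivial]
      field_simp
  rw [isLinearJacobiRelation_iff hD]
  constructor
  · rintro h _ ⟨x, v, u, w, hv, hu, hw, rfl⟩
    have h1 := (key x v u w (by rintro rfl; simp at hv) (by rintro rfl; simp at hu)
      (by rintro rfl; simp at hw)).2 (by rw [h])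
    simpa [hv, hu, hw] using h1
  · intro h x v u
    rcases eq_or_ne v 0 with rfl | hv
    · have h0 (k : ℕ) : jacobiOperator hD k (0 : TangentSpace (𝓡 n) x) = 0 := by
        simpa using jacobiOperator_smul hD k 0 (0 : TangentSpace (𝓡 n) x)
      simp [h0]
    rcases eq_or_ne u 0 with rfl | hu
    · simp
    refine ext_inner_right ℝ fun w ↦ ?_
    rcases eq_or_ne w 0 with rfl | hw
    · simp
    exact (key x v u w hv hu hw).1 (h _ (jetSeq_normalize_mem hD hv hu hw))

end Relation

/-! ### Traces of the operators 𝓡_k(v) and their derivatives. -/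

lemma LinearMap.trace_eq_sum_of_apply_eq {V ι : Type*} [AddCommGroup V] [Module ℝ V] [Fintype ι]
    (b : Module.Basis ι ℝ V) (B : V →ₗ[ℝ] V) (c : ι → ι → ℝ)
    (h : ∀ i, B (b i) = ∑ k, c i k • b k) : LinearMap.trace ℝ V B = ∑ i, c i i := by
  classical
  rw [LinearMap.trace_eq_matrix_trace ℝ b, Matrix.trace]
  refine Finset.sum_congr rfl fun i _ ↦ ?_
  rw [Matrix.diag_apply, LinearMap.toMatrix_apply, h, b.repr_sum_self]

section Trace

variable {n : ℕ} {M : Type*} [TopologicalSpace M] [ChartedSpace (EuclideanSpace ℝ (Fin n)) M]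

lemma mvfderiv_sum {ι : Type} (s : Finset ι) {f : ι → M → ℝ} {x : M}
    (hf : ∀ i ∈ s, MDifferentiableAt (𝓡 n) 𝓘(ℝ) (f i) x) (v : TangentSpace (𝓡 n) x) :
    mvfderiv (𝓡 n) (fun y ↦ ∑ i ∈ s, f i y) x v = ∑ i ∈ s, mvfderiv (𝓡 n) (f i) x v := by
  classical
  induction s using Finset.induction_on with
  | empty => simp [mvfderiv_const]
  | insert a s ha ih =>
    have hs : MDifferentiableAt (𝓡 n) 𝓘(ℝ) (fun y ↦ ∑ i ∈ s, f i y) x :=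
      by
      convert! MDifferentiableAt.sum (t := s) (f := f) (z := x)
        fun i hi ↦ hf i (Finset.mem_insert_of_mem hi) using 1
      ext1 y
      simp
    simp only [Finset.sum_insert ha]
    rw [mvfderiv_fun_add (hf a (Finset.mem_insert_self a s)) hs, add_apply,
      ih fun i hi ↦ hf i (Finset.mem_insert_of_mem hi)]

lemma mvfderiv_congr {f g : M → ℝ} {x : M} (h : f =ᶠ[𝓝 x] g) :
    mvfderiv (𝓡 n) f x = mvfderiv (𝓡 n) g x := by
  simp only [mvfderiv]
  congr 1
  rw [h.mfderiv_eq]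

variable [IsManifold (𝓡 n) ∞ M]

lemma covAlong_congr_right {D : AffineConnection n M} (X : VecField n M) {Y Z : VecField n M}
    {x : M} (hY : IsSmoothField Y) (hZ : IsSmoothField Z) (h : Y =ᶠ[𝓝 x] Z) :
    covAlong D X Y x = covAlong D X Z x := by
  rw [covAlong, covAlong, D.isCovariantDerivativeOnUniv.congr_of_eventuallyEq
    (hY.mdifferentiableAt x) (hZ.mdifferentiableAt x) Filter.univ_mem h]

omit [IsManifold (𝓡 n) ∞ M] in
lemma sum_field_apply {ι : Type*} (s : Finset ι) (Y : ι → VecField n M) (x : M) :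
    (∑ i ∈ s, Y i) x = ∑ i ∈ s, Y i x :=
  Finset.sum_apply _ _ _

lemma covAlong_sum_right {ι : Type*} (D : AffineConnection n M) (X : VecField n M) (s : Finset ι)
    {Y : ι → VecField n M} (hY : ∀ i, IsSmoothField (Y i)) :
    covAlong D X (∑ i ∈ s, Y i) = ∑ i ∈ s, covAlong D X (Y i) := by
  classical
  induction s using Finset.induction_on with
  | empty =>
    simpa using covAlong_const_smul_right D (X := X) 0 (isSmoothField_zero (n := n) (M := M))
  | insert a s ha ih =>
    rw [Finset.sum_insert ha, Finset.sum_insert ha,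
      covAlong_add_right D (hY a) (.sum fun i _ ↦ hY i), ih]

variable [T2Space M]

/-- The trace of the operator `𝓡_k(v)`. -/
def jacobiTrace {D : AffineConnection n M} (hD : D.ContMDiffCovariantDerivative ∞) (k : ℕ) {x : M}
    (v : TangentSpace (𝓡 n) x) : ℝ :=
  LinearMap.trace ℝ _ (jacobiOperator hD k v)

lemma mvfderiv_jacobiTrace {D : AffineConnection n M} (hD : D.ContMDiffCovariantDerivative ∞)
    {X : VecField n M} (hX : IsSmoothField X) (k : ℕ) {x : M} (hXX : covAlong D X X x = 0) :
    mvfderiv (𝓡 n) (fun y ↦ jacobiTrace hD k (X y)) x (X x) = jacobiTrace hD (k + 1) (X x) := by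
  obtain ⟨E, hE, hfr, hcoeff⟩ := exists_smooth_frame_coeff (n := n) x
  have hS i := hX.symCurvature hD (hE i) k
  choose c hc hcE using fun i ↦ hcoeff _ (hS i)
  have h1 : (fun y ↦ jacobiTrace hD k (X y)) =ᶠ[𝓝 x] fun y ↦ ∑ i, c i i y := by
    filter_upwards [hfr, Filter.eventually_all.2 hcE] with y hy h
    refine LinearMap.trace_eq_sum_of_apply_eq (Module.Basis.mk hy.1 hy.2) _
      (fun i k ↦ c i k y) fun i ↦ ?_
    have := h i
    rw [symCurvature_apply hD hX (hE i)] at this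
    simpa using this
  rw [mvfderiv_congr h1, mvfderiv_sum _ fun i _ ↦ (hc i i).mdifferentiable (by simp) x]
  let b := Module.Basis.mk hfr.self_of_nhds.1 hfr.self_of_nhds.2
  have hb i : b i = E i x := by simp [b]
  -- The matrix of W is the connection matrix of the frame in the direction X. Differentiating the
  -- matrix of 𝓡_k(X) gives 𝓡_(k+1)(X) plus a commutator with W, whose trace is zero.
  let W : TangentSpace (𝓡 n) x →ₗ[ℝ] TangentSpace (𝓡 n) x :=
    b.constr ℝ fun i ↦ covAlong D X (E i) x
  have hW i : W (E i x) = covAlong D X (E i) x := by rw [← hb, b.constr_basis]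
  set B := jacobiOperator hD k (X x)
  set B' := jacobiOperator hD (k + 1) (X x) with hB'
  have h2 : LinearMap.trace ℝ _ (B' + B ∘ₗ W - W ∘ₗ B) =
      ∑ i, mvfderiv (𝓡 n) (c i i) x (X x) := by
    refine LinearMap.trace_eq_sum_of_apply_eq b _
      (fun i k ↦ mvfderiv (𝓡 n) (c i k) x (X x)) fun i ↦ ?_
    have h3 := covAlong_symCurvature hD hX (hE i) k hXX
    have h4 : B (E i x) = ∑ j, c i j x • E j x := by
      have := (hcE i).self_of_nhds
      rwa [symCurvature_apply hD hX (hE i)] at this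
    have h6 : symCurvature D k X (E i) =ᶠ[𝓝 x] ∑ j, c i j • E j := by
      filter_upwards [hcE i] with y hy
      rw [hy]
      exact (sum_field_apply Finset.univ (fun j ↦ c i j • E j) y).symm
    have hcE' j : IsSmoothField (c i j • E j) := (hE j).smul (hc i j)
    rw [covAlong_congr_right X (hS i) (.sum fun j _ ↦ hcE' j) h6, covAlong_sum_right D X _ hcE',
      symCurvature_apply hD hX (hE i), symCurvature_apply hD hX (hX.covAlong hD (hE i)),
      sum_field_apply] at h3
    simp only [covAlong_smul_right D (hc i _) (hE _)] at h3
    simp only [hb, LinearMap.sub_apply, LinearMap.add_apply, LinearMap.comp_apply, hW, h4, map_sum,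
      map_smul]
    rw [sub_eq_iff_eq_add, ← h3, ← Finset.sum_add_distrib]
    exact Finset.sum_congr rfl fun j _ ↦ add_comm _ _
  rw [← h2, map_sub, map_add, LinearMap.trace_comp_comm', add_sub_cancel_right]
  rfl

end Trace

/-! ### Locality and algebraic symmetries of the curvature. -/

section CurvatureSymmetries

variable {n : ℕ} {M : Type*} [TopologicalSpace M] [ChartedSpace (EuclideanSpace ℝ (Fin n)) M]
  [IsManifold (𝓡 n) ∞ M] {D : AffineConnection n M} {X X' Y Y' Z Z' : VecField n M}

lemma IsSmoothField.mdifferentiableAt_of_eventuallyEq {x : M} (hY' : IsSmoothField Y')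
    (h : Y =ᶠ[𝓝 x] Y') :
    MDifferentiableAt (𝓡 n) (𝓡 n).tangent (fun y ↦ (⟨y, Y y⟩ : TangentBundle (𝓡 n) M)) x := by
  refine (hY'.mdifferentiableAt x).congr_of_eventuallyEq ?_
  filter_upwards [h] with y hy
  rw [hy]

lemma covAlong_eventuallyEq {x : M} (hY' : IsSmoothField Y') (hX : X =ᶠ[𝓝 x] X')
    (hY : Y =ᶠ[𝓝 x] Y') : covAlong D X Y =ᶠ[𝓝 x] covAlong D X' Y' := by
  filter_upwards [hX, hY.eventuallyEq_nhds] with y h1 h2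
  rw [covAlong, covAlong, h1, D.isCovariantDerivativeOnUniv.congr_of_eventuallyEq
    (hY'.mdifferentiableAt_of_eventuallyEq h2) (hY'.mdifferentiableAt y) Filter.univ_mem h2]

/-- The fields in `ricciTensor` are smooth only near the point; this allows replacing them by global
ones with the same germs. -/
lemma curvatureField_congr (hD : D.ContMDiffCovariantDerivative ∞) {x : M}
    (hX' : IsSmoothField X') (hY' : IsSmoothField Y') (hZ' : IsSmoothField Z')
    (hX : X =ᶠ[𝓝 x] X') (hY : Y =ᶠ[𝓝 x] Y') (hZ : Z =ᶠ[𝓝 x] Z') :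
    curvatureField D X Y Z x = curvatureField D X' Y' Z' x := by
  simp only [curvatureField, Pi.sub_apply]
  rw [(covAlong_eventuallyEq (hY'.covAlong hD hZ') hX
      (covAlong_eventuallyEq hZ' hY hZ)).self_of_nhds,
    (covAlong_eventuallyEq (hX'.covAlong hD hZ') hY
      (covAlong_eventuallyEq hZ' hX hZ)).self_of_nhds,
    (covAlong_eventuallyEq hZ' (hX.mlieBracket_vectorField hY) hZ).self_of_nhds]

lemma covAlong_sub_covAlong (hD : D.torsion = 0) (hX : IsSmoothField X) (hY : IsSmoothField Y) :
    covAlong D X Y - covAlong D Y X = VectorField.mlieBracket (𝓡 n) X Y := by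
  ext1 x
  have h := congr($hD x (X x) (Y x))
  rw [D.torsion_apply (hX.mdifferentiableAt x) (hY.mdifferentiableAt x)] at h
  exact sub_eq_zero.1 h

lemma curvatureField_swap : curvatureField D X Y Z = -curvatureField D Y X Z := by
  have : VectorField.mlieBracket (𝓡 n) X Y = -VectorField.mlieBracket (𝓡 n) Y X :=
    VectorField.mlieBracket_swap
  have h2 : covAlong D (-VectorField.mlieBracket (𝓡 n) Y X) Z =
      -covAlong D (VectorField.mlieBracket (𝓡 n) Y X) Z := by
    ext1 x
    simp [covAlong]
  rw [curvatureField, curvatureField, this, h2]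
  abel

/-- The first Bianchi identity. -/
lemma bianchi_curvatureField (hD : D.ContMDiffCovariantDerivative ∞) (hDt : D.torsion = 0)
    (hX : IsSmoothField X) (hY : IsSmoothField Y) (hZ : IsSmoothField Z) :
    curvatureField D X Y Z + curvatureField D Y Z X + curvatureField D Z X Y = 0 := by
  have key {X Y Z : VecField n M} (hX : IsSmoothField X) (hY : IsSmoothField Y)
      (hZ : IsSmoothField Z) : covAlong D X (covAlong D Y Z) = covAlong D X (covAlong D Z Y) +
        covAlong D (VectorField.mlieBracket (𝓡 n) Y Z) X +
        VectorField.mlieBracket (𝓡 n) X (VectorField.mlieBracket (𝓡 n) Y Z) := by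
    have h := covAlong_sub_covAlong hDt hY hZ
    rw [← covAlong_sub_covAlong hDt hX (hY.mlieBracket hZ), ← h,
      covAlong_sub_right D (hY.covAlong hD hZ) (hZ.covAlong hD hY)]
    abel
  have hJ := jacobi_mlieBracket hX hY hZ
  have e1 : VectorField.mlieBracket (𝓡 n) Z (VectorField.mlieBracket (𝓡 n) X Y) =
      -VectorField.mlieBracket (𝓡 n) (VectorField.mlieBracket (𝓡 n) X Y) Z :=
    VectorField.mlieBracket_swap
  have e2 : VectorField.mlieBracket (𝓡 n) Y (VectorField.mlieBracket (𝓡 n) Z X) =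
      -VectorField.mlieBracket (𝓡 n) Y (VectorField.mlieBracket (𝓡 n) X Z) := by
    have h : VectorField.mlieBracket (𝓡 n) Z X = (-1 : ℝ) • VectorField.mlieBracket (𝓡 n) X Z := by
      rw [neg_one_smul]; exact VectorField.mlieBracket_swap
    rw [h]
    ext1 x
    have := VectorField.mlieBracket_const_smul_right (I := 𝓡 n) (c := (-1 : ℝ)) (V := Y)
      ((hX.mlieBracket hZ).mdifferentiableAt x)
    rw [this]
    simp
  simp only [curvatureField]
  rw [key hX hY hZ, key hY hZ hX, key hZ hX hY, e1, e2, hJ]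
  abel

variable [RiemannianBundle (fun x : M ↦ TangentSpace (𝓡 n) x)]
  [IsContMDiffRiemannianBundle (𝓡 n) ∞ (EuclideanSpace ℝ (Fin n))
    (fun x : M ↦ TangentSpace (𝓡 n) x)]

/-- The commutator identity for [X, Y] acting on the function |Z|², with metric compatibility
applied twice; the mixed first-order terms cancel. -/
lemma inner_curvatureField_self [T2Space M] (hD : D.ContMDiffCovariantDerivative ∞)
    (hDm : D.IsMetricCompatible) (hX : IsSmoothField X) (hY : IsSmoothField Y)
    (hZ : IsSmoothField Z) (x : M) : inner ℝ (curvatureField D X Y Z x) (Z x) = 0 := by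
  have h1 {X : VecField n M} (y : M) : mvfderiv (𝓡 n) (fun y ↦ inner ℝ (Z y) (Z y)) y (X y) =
      2 * inner ℝ (covAlong D X Z y) (Z y) := by
    rw [mvfderiv_inner_field hDm hZ hZ, real_inner_comm (covAlong D X Z y) (Z y)]
    ring
  have h2 {X Y : VecField n M} (hY : IsSmoothField Y) :
      mvfderiv (𝓡 n) (fun y ↦ 2 * inner ℝ (covAlong D Y Z y) (Z y)) x (X x) =
      2 * (inner ℝ (covAlong D X (covAlong D Y Z) x) (Z x) +
        inner ℝ (covAlong D Y Z x) (covAlong D X Z x)) := by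
    have hYZ := hY.covAlong hD hZ
    rw [mvfderiv_fun_mul mdifferentiableAt_const ((hYZ.inner hZ).mdifferentiable (by simp) x),
      mvfderiv_const, ← mvfderiv_inner_field hDm hYZ hZ]
    simp
  have h := mvfderiv_mlieBracket (hZ.inner hZ) hX hY x
  simp only [h1, h2 hX, h2 hY] at h
  simp only [curvatureField, Pi.sub_apply, inner_sub_left]
  rw [real_inner_comm (covAlong D X Z x) (covAlong D Y Z x)] at h
  linarith

end CurvatureSymmetries

/-! ### The Ricci tensor as a trace, and the Killing condition. -/

section Ricci

variable {n : ℕ} {M : Type*} [TopologicalSpace M] [ChartedSpace (EuclideanSpace ℝ (Fin n)) M]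
  [IsManifold (𝓡 n) ∞ M] [T2Space M] {D : AffineConnection n M}

/-- The curvature `R_{u,v} w` of tangent vectors. -/
def curvatureAt (hD : D.ContMDiffCovariantDerivative ∞) {x : M} (u v w : TangentSpace (𝓡 n) x) :
    TangentSpace (𝓡 n) x :=
  (isTensorField_curvatureTensor hD).toMultilinear x ![u, v, w]

lemma curvatureAt_eq (hD : D.ContMDiffCovariantDerivative ∞) {x : M}
    (u v w : TangentSpace (𝓡 n) x) : curvatureAt hD u v w =
      curvatureField D (smoothExtend u) (smoothExtend v) (smoothExtend w) x :=
  rfl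

lemma curvatureAt_add_middle (hD : D.ContMDiffCovariantDerivative ∞) {x : M}
    (u v v' w : TangentSpace (𝓡 n) x) :
    curvatureAt hD u (v + v') w = curvatureAt hD u v w + curvatureAt hD u v' w := by
  have e (z : TangentSpace (𝓡 n) x) : Function.update ![u, v, w] 1 z = ![u, z, w] := by
    ext1 i; fin_cases i <;> rfl
  have := ((isTensorField_curvatureTensor hD).toMultilinear x).map_update_add ![u, v, w] 1 v v'
  simp only [e] at this
  exact this

lemma curvatureAt_add_right (hD : D.ContMDiffCovariantDerivative ∞) {x : M}
    (u v w w' : TangentSpace (𝓡 n) x) :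
    curvatureAt hD u v (w + w') = curvatureAt hD u v w + curvatureAt hD u v w' := by
  have e (z : TangentSpace (𝓡 n) x) : Function.update ![u, v, w] 2 z = ![u, v, z] := by
    ext1 i; fin_cases i <;> rfl
  have := ((isTensorField_curvatureTensor hD).toMultilinear x).map_update_add ![u, v, w] 2 w w'
  simp only [e] at this
  exact this

variable [RiemannianBundle (fun x : M ↦ TangentSpace (𝓡 n) x)]

lemma ricciTensor_eq (hD : D.ContMDiffCovariantDerivative ∞) {x : M}
    (v w : TangentSpace (𝓡 n) x) : ricciTensor D x v w =
      ∑ i, inner ℝ (curvatureAt hD (stdOrthonormalBasis ℝ (TangentSpace (𝓡 n) x) i) v w)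
        (stdOrthonormalBasis ℝ (TangentSpace (𝓡 n) x) i) := by
  refine Finset.sum_congr rfl fun i _ ↦ ?_
  rw [curvatureAt_eq, curvatureField_congr hD (isSmoothField_smoothExtend _)
    (isSmoothField_smoothExtend v) (isSmoothField_smoothExtend w)
    (smoothExtend_eventuallyEq _).symm (smoothExtend_eventuallyEq v).symm
    (smoothExtend_eventuallyEq w).symm]

lemma ricciTensor_add_left (hD : D.ContMDiffCovariantDerivative ∞) {x : M}
    (v v' w : TangentSpace (𝓡 n) x) :
    ricciTensor D x (v + v') w = ricciTensor D x v w + ricciTensor D x v' w := by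
  simp only [ricciTensor_eq hD, curvatureAt_add_middle, inner_add_left, Finset.sum_add_distrib]

lemma ricciTensor_add_right (hD : D.ContMDiffCovariantDerivative ∞) {x : M}
    (v w w' : TangentSpace (𝓡 n) x) :
    ricciTensor D x v (w + w') = ricciTensor D x v w + ricciTensor D x v w' := by
  simp only [ricciTensor_eq hD, curvatureAt_add_right, inner_add_left, Finset.sum_add_distrib]

lemma ricciTensor_self (hD : D.ContMDiffCovariantDerivative ∞) {x : M}
    (v : TangentSpace (𝓡 n) x) : ricciTensor D x v v = jacobiTrace hD 0 v := by
  rw [jacobiTrace, LinearMap.trace_eq_sum_inner _ (stdOrthonormalBasis ℝ (TangentSpace (𝓡 n) x)),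
    ricciTensor_eq hD]
  refine Finset.sum_congr rfl fun i _ ↦ ?_
  rw [real_inner_comm]
  congr 1

variable [IsContMDiffRiemannianBundle (𝓡 n) ∞ (EuclideanSpace ℝ (Fin n))
    (fun x : M ↦ TangentSpace (𝓡 n) x)]

/-- Pair the Bianchi identity for e, v, w with e. The term ⟨R_{v,w} e, e⟩ is zero, and the other two
are the summands of the two sides. -/
lemma ricciTensor_symm (hD : IsLeviCivita D) {x : M} (v w : TangentSpace (𝓡 n) x) :
    ricciTensor D x v w = ricciTensor D x w v := by
  rw [ricciTensor_eq hD.smooth, ricciTensor_eq hD.smooth]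
  refine Finset.sum_congr rfl fun i _ ↦ ?_
  set e := stdOrthonormalBasis ℝ (TangentSpace (𝓡 n) x) i
  have h1 := congrFun (bianchi_curvatureField hD.smooth hD.torsion_free
    (isSmoothField_smoothExtend e) (isSmoothField_smoothExtend v) (isSmoothField_smoothExtend w)) x
  have h2 := inner_curvatureField_self hD.smooth hD.metric (isSmoothField_smoothExtend v)
    (isSmoothField_smoothExtend w) (isSmoothField_smoothExtend e) x
  rw [curvatureField_swap (X := smoothExtend w) (Y := smoothExtend e)] at h1
  rw [smoothExtend_self] at h2
  simp only [curvatureAt_eq]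
  have h3 := congrArg (fun z ↦ inner ℝ z e) h1
  simp only [Pi.add_apply, Pi.neg_apply, Pi.zero_apply, inner_add_left, inner_neg_left, h2,
    inner_zero_left] at h3
  linarith

lemma ricciTensor_eq_zero_of_self (hD : IsLeviCivita D) {x : M}
    (h : ∀ v : TangentSpace (𝓡 n) x, ricciTensor D x v v = 0) (v w : TangentSpace (𝓡 n) x) :
    ricciTensor D x v w = 0 := by
  have h1 := h (v + w)
  rw [ricciTensor_add_left hD.smooth, ricciTensor_add_right hD.smooth,
    ricciTensor_add_right hD.smooth, h, h, ricciTensor_symm hD w v] at h1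
  linarith

/-- The Killing condition says that the derivative of tr 𝓡_0(X) along X is zero, that is, tr 𝓡_1 =
0. The higher traces are iterated derivatives of this. -/
lemma jacobiTrace_succ_eq_zero (hD : IsLeviCivita D) (hK : IsKillingTensor D (ricciTensor D))
    (k : ℕ) : ∀ {x : M} (v : TangentSpace (𝓡 n) x), jacobiTrace hD.smooth (k + 1) v = 0 := by
  induction k with
  | zero =>
    intro x v
    obtain ⟨X, hX, rfl, hDX⟩ := exists_isSmoothField_cov_eq_zero D v v
    have hXX : covAlong D X X x = 0 := hDX
    have hl : ricciTensor D x 0 (X x) = 0 := by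
      simpa using ricciTensor_add_left hD.smooth 0 0 (X x)
    have hr : ricciTensor D x (X x) 0 = 0 := by
      simpa using ricciTensor_add_right hD.smooth (X x) 0 0
    have h := hK X hX x
    rw [hXX, hl, hr] at h
    simp only [ricciTensor_self hD.smooth, sub_zero] at h
    rw [← h, mvfderiv_jacobiTrace hD.smooth hX 0 hXX]
  | succ k ih =>
    intro x v
    obtain ⟨X, hX, rfl, hDX⟩ := exists_isSmoothField_cov_eq_zero D v v
    rw [← mvfderiv_jacobiTrace hD.smooth hX (k + 1) hDX]
    simp [ih, mvfderiv_const]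

/-- If the Ricci tensor is a Killing tensor, then it vanishes in the presence of a linear Jacobi
relation of odd order with non-zero last coefficient. -/
lemma ricciTensor_eq_zero_of_odd (hD : IsLeviCivita D) (hK : IsKillingTensor D (ricciTensor D))
    {d : ℕ} {a : ℕ → ℝ} (ha : IsLinearJacobiRelation D d a) (hd : Even (d + 1))
    (hpos : ∀ i ∈ Finset.Icc 1 ((d + 1) / 2), 0 < a (2 * i)) (x : M)
    (v w : TangentSpace (𝓡 n) x) : ricciTensor D x v w = 0 := by
  refine ricciTensor_eq_zero_of_self hD (fun v ↦ ?_) v w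
  rw [ricciTensor_self hD.smooth]
  rcases eq_or_ne v 0 with rfl | hv
  · have := jacobiOperator_smul hD.smooth 0 0 (0 : TangentSpace (𝓡 n) x)
    rw [zero_smul, zero_pow (by simp), zero_smul] at this
    rw [jacobiTrace, this, map_zero]
  obtain ⟨m, hm⟩ := hd
  have hm2 : (d + 1) / 2 = m := by omega
  have h1 : jacobiOperator hD.smooth (d + 1) v = -∑ i ∈ Finset.Icc 1 ((d + 1) / 2),
      (a (2 * i) * ‖v‖ ^ (2 * i)) • jacobiOperator hD.smooth (d + 1 - 2 * i) v := by
    ext1 u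
    rw [(isLinearJacobiRelation_iff hD.smooth).1 ha]
    simp only [LinearMap.neg_apply, LinearMap.sum_apply, LinearMap.smul_apply]
  have h2 := congrArg (LinearMap.trace ℝ _) h1
  simp only [map_neg, map_sum, map_smul] at h2
  change jacobiTrace hD.smooth (d + 1) v = -∑ i ∈ Finset.Icc 1 ((d + 1) / 2),
    (a (2 * i) * ‖v‖ ^ (2 * i)) * jacobiTrace hD.smooth (d + 1 - 2 * i) v at h2
  rw [jacobiTrace_succ_eq_zero hD hK, Finset.sum_eq_single m] at h2
  · have h3 := hpos m (Finset.mem_Icc.2 ⟨by omega, by omega⟩)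
    have h4 : 0 < ‖v‖ := norm_pos_iff.2 hv
    rw [show d + 1 - 2 * m = 0 by omega] at h2
    have h5 : a (2 * m) * ‖v‖ ^ (2 * m) ≠ 0 := by positivity
    exact (mul_eq_zero.1 (neg_eq_zero.1 h2.symm)).resolve_left h5
  · intro i hi him
    have := Finset.mem_Icc.1 hi
    rw [show d + 1 - 2 * i = d - 2 * i + 1 by omega, jacobiTrace_succ_eq_zero hD hK, mul_zero]
  · intro h
    exact absurd (Finset.mem_Icc.2 ⟨by omega, by omega⟩) h

end Ricci

/-! ### Assembling the theorem. -/

lemma IsNaturallyReductive.isParallelPair {n : ℕ} {M : Type*} [EMetricSpace M]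
    [ChartedSpace (EuclideanSpace ℝ (Fin n)) M] [IsManifold (𝓡 n) ∞ M]
    [RiemannianBundle (fun x : M ↦ TangentSpace (𝓡 n) x)]
    [IsContMDiffRiemannianBundle (𝓡 n) ∞ (EuclideanSpace ℝ (Fin n))
      (fun x : M ↦ TangentSpace (𝓡 n) x)]
    [IsRiemannianManifold (𝓡 n) M] {D D' : AffineConnection n M} (hD : IsLeviCivita D)
    (h : IsNaturallyReductive D D') : IsParallelPair D D' where
  smooth := hD.smooth
  smooth' := h.ambrose_singer.smooth
  alternating x u := by
    -- Taking τ(u, u, w) with w = A_u u turns the condition into |A_u u|² = 0.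
    have h1 := (h.alternating x u (D'.difference D x u u)).1
    rw [differenceTensor] at h1
    exact inner_self_eq_zero.1 ((mul_eq_zero.1 h1).resolve_left two_ne_zero)
  torsion_free := hD.torsion_free
  parallel_torsion := h.ambrose_singer.parallel_torsion
  parallel_curvature := h.ambrose_singer.parallel_curvature

end

theorem proposition2p4 (n : ℕ) (M : Type*) [EMetricSpace M]
    [ChartedSpace (EuclideanSpace ℝ (Fin n)) M] [IsManifold (𝓡 n) ∞ M]
    [RiemannianBundle (fun x : M ↦ TangentSpace (𝓡 n) x)]
    [IsContMDiffRiemannianBundle (𝓡 n) ∞ (EuclideanSpace ℝ (Fin n))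
      (fun x : M ↦ TangentSpace (𝓡 n) x)]
    [IsRiemannianManifold (𝓡 n) M]
    (D : AffineConnection n M) (hD : IsLeviCivita D)
    (hM : CompactSpace M ∨ ∃ D' : AffineConnection n M, IsNaturallyReductive D D')
    (d : ℕ) (a : ℕ → ℝ) (ha : IsMinimalLinearJacobiRelation D d a) :
    (∀ z : ℂ, ((jacobiPolynomial d a).map (algebraMap ℝ ℂ)).IsRoot z →
      z.re = 0 ∧ ((jacobiPolynomial d a).map (algebraMap ℝ ℂ)).rootMultiplicity z = 1) ∧
    (∀ i ∈ Finset.Icc 1 ((d + 1) / 2), 0 < a (2 * i)) ∧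
    ∃ lam : Fin ((d + 1) / 2) → ℝ, StrictMono lam ∧ (∀ l, 0 < lam l) ∧
      (jacobiPolynomial d a = ∏ l, (X ^ 2 + C (lam l ^ 2)) ∨
        jacobiPolynomial d a = X * ∏ l, (X ^ 2 + C (lam l ^ 2))) ∧
      (IsKillingTensor D (ricciTensor D) →
        (∃ (x : M) (v w : TangentSpace (𝓡 n) x), ricciTensor D x v w ≠ 0) →
        jacobiPolynomial d a = X * ∏ l, (X ^ 2 + C (lam l ^ 2)) ∧ Even d) := by
  have hflow : ∀ y ∈ jetSet hD.smooth, ∃ S ⊆ jetSet hD.smooth, IsShiftFlow S ∧ y ∈ S := by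
    intro y hy
    rcases hM with hM | ⟨D', hD'⟩
    · exact ⟨_, subset_rfl, isShiftFlow_jetSet hD.smooth hD.metric, hy⟩
    · refine (hD'.isParallelPair hD).exists_isShiftFlow (fun x v u ↦ ?_) hy
      -- The condition τ(v, u, u) = 0 is the skew-symmetry of A_v.
      have h := (hD'.alternating x v u).2.1
      rw [differenceTensor] at h
      exact (mul_eq_zero.1 h).resolve_left two_ne_zero
  have hroots (z : ℂ) (hz : ((jacobiPolynomial d a).map (algebraMap ℝ ℂ)).IsRoot z) :=
    isRoot_jacobiPolynomial (jetSet_sign hD.smooth) hflow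
      ((isLinearJacobiRelation_iff_jetSet hD.smooth).1 ha.1)
      (fun d' a' h ↦ ha.2 d' a' ((isLinearJacobiRelation_iff_jetSet hD.smooth).2 h)) hz
  obtain ⟨lam, hmono, hpos, hP⟩ := exists_eq_prod_of_imaginary_roots
    (monic_jacobiPolynomial d a) hroots
  -- The type of `lam` depends on the degree, which must be a variable before d + 1 can be
  -- substituted for it.
  generalize hN : (jacobiPolynomial d a).natDegree = N at lam hmono hpos hP
  rw [natDegree_jacobiPolynomial] at hN
  subst hN
  have hcoeff := fun i hi ↦ jacobiPolynomial_coeff_pos hpos hP (i := i) hi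
  refine ⟨hroots, hcoeff, lam, hmono, hpos, hP.imp And.left And.left, ?_⟩
  rintro hK ⟨x, v, w, hne⟩
  rcases hP with ⟨-, hd⟩ | ⟨hP, hd⟩
  · exact absurd (ricciTensor_eq_zero_of_odd hD hK ha.1 hd hcoeff x v w) hne
  · exact ⟨hP, by simpa [Nat.odd_add_one] using hd⟩
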